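/- Let $N\in\mathbb N$, $1<p<N$ and $\beta>p$. There is $\theta_0=\theta_0(p,\beta,N)$ with $0<\theta_0\le 1$ such that for all $q>N$ and $\lambda>0$ there is a function $C=C(p,q,\beta,N,\lambda;\,\cdot\,):[0,\infty)^5\to[0,\infty)$, nondecreasing in each of its five variables, for which the following holds. Let $\Omega\subset\mathbb R^N$ be open, and let $\mathcal A:\Omega\times\mathbb R\times\mathbb R^N\to\mathbb R^N$ and $\mathcal B:\Omega\times\mathbb R\times\mathbb R^N\to\mathbb R$ be Carathéodory functions (Lebesgue measurable in $x$, and continuous in $(\zeta,\xi)$ for a.e. $x$) such that, for a.e. $x\in\Omega$ and all $\zeta\in\mathbb R$, $\xi\in\mathbb R^N$, $$\mathcal A(x,\zeta,\xi)\cdot\xi\ \ge\ \lambda|\xi|^p-a_1(x)|\zeta|^p-a_2(x),\qquad |\mathcal B(x,\zeta,\xi)|\ \le\ b_1(x)|\xi|^{p-1}+b_2(x)|\zeta|^{p-1}+b_3(x),$$ with nonnegative functions $b_1\in L^\infty(\Omega)$, $a_1,b_2\in L^{q/p}(\Omega)$, $a_2\in L^{\beta/p}(\Omega)\cap L^\infty(\Omega)$,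 $b_3\in L^{\beta/(p-1)}(\Omega)\cap L^\infty(\Omega)$. Let $D^{1,p}(\Omega)$ be the completion of $C_c^\infty(\Omega)$ under $\|u\|=(\int_\Omega|\nabla u|^p)^{1/p}$, realized by the Sobolev inequality as a space of functions in $L^{p^*}(\Omega)$, $p^*=\frac{Np}{N-p}$, with gradients in $L^p(\Omega)$. Let $u\in D^{1,p}(\Omega)\cap L^\beta(\Omega)$ be a weak supersolution of $-\operatorname{div}\mathcal A(x,u,\nabla u)=\mathcal B(x,u,\nabla u)$, that is, for every $\varphi\in D^{1,p}(\Omega)$ with $\varphi\ge0$ the functions $\mathcal A(x,u,\nabla u)\cdot\nabla\varphi$ and $\mathcal B(x,u,\nabla u)\varphi$ are integrable on $\Omega$ and $$\int_\Omega\mathcal A(x,u,\nabla u)\cdot\nabla\varphi\,dx\ \ge\ \int_\Omega\mathcal B(x,u,\nabla u)\,\varphi\,dx .$$ Then $u^-=\max\{-u,0\}$ satisfies $$\operatorname*{ess\,sup}_\Omega u^-\ \le\ C\,\max\big\{|u^-|_{\beta}^{\theta_0},\ |u^-|_{\beta}\big\},$$ where $|\cdot|_r$ is the norm of $L^r(\Omega)$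 and $C$ is evaluated at $\big(|b_1|_\infty,\ |a_1|_{q/p},\ |b_2|_{q/p},\ |a_2|_{\beta/p}+|a_2|_\infty,\ |b_3|_{\beta/(p-1)}+|b_3|_\infty\big)$. -/

import Mathlib

open MeasureTheory Filter Topology
open scoped NNReal ENNReal ContDiff

noncomputable section

/-- `φ ∈ C_c^∞(Ω)`. -/
def IsTestFunction {N : ℕ} (Ω : Set (EuclideanSpace ℝ (Fin N)))
    (φ : EuclideanSpace ℝ (Fin N) → ℝ) : Prop :=
  ContDiff ℝ ∞ φ ∧ HasCompactSupport φ ∧ tsupport φ ⊆ Ω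

/-- The critical Sobolev exponent `p* = N p / (N - p)`, for `1 < p < N`. -/
def sobolevExponent (N : ℕ) (p : ℝ) : ℝ := N * p / (N - p)

/-- `u ∈ D^{1,p}(Ω)` with `∇u = G`, for `1 < p < N`. The space `D^{1,p}(Ω)` is the completion of
`C_c^∞(Ω)` under `φ ↦ (∫_Ω |∇φ|^p)^{1/p}`. By the Sobolev inequality a sequence in `C_c^∞(Ω)` that
is Cauchy for this norm is Cauchy in `L^{p*}(Ω)`, so that the elements of the completion are
functions in `L^{p*}(Ω)`: the pairs `(u, G)` below are exactly the limits in `L^{p*} × L^p` of the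
pairs `(φₙ, ∇φₙ)`. In particular `G` is the weak gradient of `u` on `Ω`, and is determined by `u`
up to null sets. Values outside `Ω` play no role. -/
def MemD1p {N : ℕ} (p : ℝ) (Ω : Set (EuclideanSpace ℝ (Fin N)))
    (u : EuclideanSpace ℝ (Fin N) → ℝ)
    (G : EuclideanSpace ℝ (Fin N) → EuclideanSpace ℝ (Fin N)) : Prop :=
  MemLp u (ENNReal.ofReal (sobolevExponent N p)) (volume.restrict Ω) ∧
  MemLp G (ENNReal.ofReal p) (volume.restrict Ω) ∧
  ∃ φ : ℕ → EuclideanSpace ℝ (Fin N) → ℝ,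
    (∀ n, IsTestFunction Ω (φ n)) ∧
    Tendsto (fun n => eLpNorm (fun x => gradient (φ n) x - G x)
      (ENNReal.ofReal p) (volume.restrict Ω)) atTop (𝓝 0) ∧
    Tendsto (fun n => eLpNorm (fun x => φ n x - u x)
      (ENNReal.ofReal (sobolevExponent N p)) (volume.restrict Ω)) atTop (𝓝 0)

/-- Carathéodory functions `f(x, ζ, ξ)` on `Ω × ℝ × ℝ^N`: Lebesgue measurable in `x ∈ Ω`, and
continuous in `(ζ, ξ)` for almost every `x ∈ Ω`. -/
def IsCaratheodory {N : ℕ} {F : Type*} [TopologicalSpace F]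
    (Ω : Set (EuclideanSpace ℝ (Fin N)))
    (f : EuclideanSpace ℝ (Fin N) → ℝ → EuclideanSpace ℝ (Fin N) → F) : Prop :=
  (∀ ζ ξ, AEStronglyMeasurable (fun x => f x ζ ξ) (volume.restrict Ω)) ∧
  ∀ᵐ x ∂(volume.restrict Ω),
    Continuous (fun z : ℝ × EuclideanSpace ℝ (Fin N) => f x z.1 z.2)

/-- `A(x,ζ,ξ)·ξ ≥ λ|ξ|^p - a₁(x)|ζ|^p - a₂(x)`. -/
def StructureCondA {N : ℕ} (p lam : ℝ) (Ω : Set (EuclideanSpace ℝ (Fin N)))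
    (A : EuclideanSpace ℝ (Fin N) → ℝ → EuclideanSpace ℝ (Fin N) → EuclideanSpace ℝ (Fin N))
    (a₁ a₂ : EuclideanSpace ℝ (Fin N) → ℝ) : Prop :=
  ∀ᵐ x ∂(volume.restrict Ω), ∀ (ζ : ℝ) (ξ : EuclideanSpace ℝ (Fin N)),
    lam * ‖ξ‖ ^ p - a₁ x * |ζ| ^ p - a₂ x ≤ inner ℝ (A x ζ ξ) ξ

/-- `|B(x,ζ,ξ)| ≤ b₁(x)|ξ|^{p-1} + b₂(x)|ζ|^{p-1} + b₃(x)`. -/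
def StructureCondB {N : ℕ} (p : ℝ) (Ω : Set (EuclideanSpace ℝ (Fin N)))
    (B : EuclideanSpace ℝ (Fin N) → ℝ → EuclideanSpace ℝ (Fin N) → ℝ)
    (b₁ b₂ b₃ : EuclideanSpace ℝ (Fin N) → ℝ) : Prop :=
  ∀ᵐ x ∂(volume.restrict Ω), ∀ (ζ : ℝ) (ξ : EuclideanSpace ℝ (Fin N)),
    |B x ζ ξ| ≤ b₁ x * ‖ξ‖ ^ (p - 1) + b₂ x * |ζ| ^ (p - 1) + b₃ x

/-- `u ∈ D^{1,p}(Ω)`, with gradient `Du`, is a weak supersolution of `-div A(x,u,∇u) = B(x,u,∇u)`: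
for every `0 ≤ φ ∈ D^{1,p}(Ω)` both integrals exist and
`∫_Ω A(x,u,∇u)·∇φ ≥ ∫_Ω B(x,u,∇u) φ`. -/
def IsWeakSupersolution {N : ℕ} (p : ℝ) (Ω : Set (EuclideanSpace ℝ (Fin N)))
    (A : EuclideanSpace ℝ (Fin N) → ℝ → EuclideanSpace ℝ (Fin N) → EuclideanSpace ℝ (Fin N))
    (B : EuclideanSpace ℝ (Fin N) → ℝ → EuclideanSpace ℝ (Fin N) → ℝ)
    (u : EuclideanSpace ℝ (Fin N) → ℝ)
    (Du : EuclideanSpace ℝ (Fin N) → EuclideanSpace ℝ (Fin N)) : Prop :=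
  MemD1p p Ω u Du ∧
  ∀ (φ : EuclideanSpace ℝ (Fin N) → ℝ)
    (Dφ : EuclideanSpace ℝ (Fin N) → EuclideanSpace ℝ (Fin N)),
    MemD1p p Ω φ Dφ → (∀ᵐ x ∂(volume.restrict Ω), 0 ≤ φ x) →
      IntegrableOn (fun x => inner ℝ (A x (u x) (Du x)) (Dφ x)) Ω ∧
      IntegrableOn (fun x => B x (u x) (Du x) * φ x) Ω ∧
      ∫ x in Ω, B x (u x) (Du x) * φ x ≤ ∫ x in Ω, inner ℝ (A x (u x) (Du x)) (Dφ x)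

/-- The norm `|f|_{r,Ω}` of `f ∈ L^r(Ω)` as a nonnegative real. -/
def lebNorm {N : ℕ} (f : EuclideanSpace ℝ (Fin N) → ℝ) (r : ℝ≥0∞)
    (Ω : Set (EuclideanSpace ℝ (Fin N))) : ℝ≥0 :=
  (eLpNorm f r (volume.restrict Ω)).toNNReal

end

/-! Stampacchia's method on the superlevel sets of `-u`. For `k ≥ 0` the truncation `w = (-u - k)⁺`
is an admissible test function (`MemD1p.truncation`). Testing with it and absorbing the `b₁` term by
Young's inequality bounds `∫ |∇w|^p` by a constant times the integral of `(a₁ + b₂)(w^p + k^p) + w^p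
+ 1` over `{u < -k}` (`IsWeakSupersolution.energy_le`).

Let `m(k)` be the measure of `{u < -k}`. Sobolev on the left and Hölder on the right give a bound
for `|w|_{p*}^p`. Since `q > N`, every term on the right that contains `w` carries a positive power
of `m(k)`, so it is absorbed once `m(k)` is small. Chebyshev's inequality between levels `k < h`
then gives, with `ε = p/N - p/q > 0`, `(h - k)^p m(h)^(1 - p/N) ≤ 2D (k^p m(k)^(1 - p/N + ε) +
m(k))` (`IsWeakSupersolution.measure_recursion`). Both powers of `m(k)` exceed the power on the
left, so `m` decays geometrically along levels rising from `M/2` to `M`, provided that `m(M/2)` is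
small (`stampacchia_iteration`). Hence `m(M) = 0`, that is, `u⁻ ≤ M` almost everywhere.

It remains to choose `M` (`exists_eLpNorm_top_negPart_le`). With `t = |u⁻|_β`, Chebyshev gives
`m(M/2) ≤ (2t/M)^β`. The term with `k^p` only needs `M ≥ c t`. The last term, which stems from `a₂`
and `b₃` and does not scale with `k`, needs `(t/M)^β ≲ M^N`, that is, `M ≥ c t^(β/(N+β))`. This
explains the two powers and `θ₀ = β/(N+β)`. -/

/-! ### Smooth approximation of the positive part -/

/-- A smooth function that vanishes on `(-∞, 0]` and is the identity on `[1, ∞)`. -/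
noncomputable def smoothPos (s : ℝ) : ℝ := s * Real.smoothTransition s

theorem contDiff_smoothPos : ContDiff ℝ ∞ smoothPos :=
  contDiff_id.mul Real.smoothTransition.contDiff

theorem smoothPos_of_nonpos {s : ℝ} (hs : s ≤ 0) : smoothPos s = 0 := by
  simp [smoothPos, Real.smoothTransition.zero_of_nonpos hs]

theorem smoothPos_of_one_le {s : ℝ} (hs : 1 ≤ s) : smoothPos s = s := by
  simp [smoothPos, Real.smoothTransition.one_of_one_le hs]

theorem abs_smoothPos_le (s : ℝ) : |smoothPos s| ≤ max s 0 := by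
  rcases le_total s 0 with h | h
  · simp [smoothPos_of_nonpos h]
  · rw [smoothPos, abs_mul, abs_of_nonneg h, abs_of_nonneg (Real.smoothTransition.nonneg s),
      max_eq_left h]
    exact mul_le_of_le_one_right h (Real.smoothTransition.le_one s)

theorem differentiable_smoothPos : Differentiable ℝ smoothPos :=
  contDiff_smoothPos.differentiable (by simp)

theorem continuous_deriv_smoothPos : Continuous (deriv smoothPos) :=
  contDiff_smoothPos.continuous_deriv (by simp)

theorem deriv_smoothPos_of_neg {s : ℝ} (hs : s < 0) : deriv smoothPos s = 0 := by
  have : smoothPos =ᶠ[𝓝 s] fun _ => (0 : ℝ) := by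
    filter_upwards [Iio_mem_nhds hs] with x hx using smoothPos_of_nonpos (le_of_lt hx)
  rw [this.deriv_eq]; simp

/-- The endpoint `0` follows by continuity, and it matters: since the approximations are flat at the
truncation level, the fact that `∇u = 0` a.e. on level sets is never needed. -/
theorem deriv_smoothPos_of_nonpos {s : ℝ} (hs : s ≤ 0) : deriv smoothPos s = 0 := by
  have hc : closure (Set.Iio (0 : ℝ)) ⊆ {x | deriv smoothPos x = 0} :=
    closure_minimal (fun x hx => deriv_smoothPos_of_neg hx)
      (isClosed_eq continuous_deriv_smoothPos continuous_const)
  rw [closure_Iio] at hc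
  exact hc hs

theorem deriv_smoothPos_of_one_lt {s : ℝ} (hs : 1 < s) : deriv smoothPos s = 1 := by
  have : smoothPos =ᶠ[𝓝 s] fun x => x := by
    filter_upwards [Ioi_mem_nhds hs] with x hx using smoothPos_of_one_le (le_of_lt hx)
  rw [this.deriv_eq]; simp

theorem exists_abs_deriv_smoothPos_le : ∃ L : ℝ, ∀ s, |deriv smoothPos s| ≤ L := by
  obtain ⟨L, hL⟩ := (isCompact_Icc (a := (0 : ℝ)) (b := 1)).exists_bound_of_continuousOn
    continuous_deriv_smoothPos.continuousOn
  refine ⟨max L 1, fun s => ?_⟩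
  rcases lt_or_ge s 0 with h | h
  · rw [deriv_smoothPos_of_neg h]; simp
  · rcases le_or_gt s 1 with h1 | h1
    · exact (hL s ⟨h, h1⟩).trans (le_max_left _ _)
    · rw [deriv_smoothPos_of_one_lt h1]; simp

/-- A dominated convergence theorem for `L^r` seminorms. -/
theorem tendsto_eLpNorm_zero_of_dominated {α F : Type*} [MeasurableSpace α] {μ : Measure α}
    [NormedAddCommGroup F] {r : ℝ} (hr : 0 < r) {h : ℕ → α → F} {g : α → ℝ}
    (hm : ∀ n, AEStronglyMeasurable (h n) μ) (hg : MemLp g (ENNReal.ofReal r) μ)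
    (hb : ∀ n, ∀ᵐ x ∂μ, ‖h n x‖ ≤ g x)
    (hl : ∀ᵐ x ∂μ, Tendsto (fun n => h n x) atTop (𝓝 0)) :
    Tendsto (fun n => eLpNorm (h n) (ENNReal.ofReal r) μ) atTop (𝓝 0) := by
  have h0 : ENNReal.ofReal r ≠ 0 := by simpa using hr
  simp only [eLpNorm_eq_lintegral_rpow_enorm_toReal h0 ENNReal.ofReal_ne_top,
    ENNReal.toReal_ofReal hr.le]
  have key : Tendsto (fun n => ∫⁻ x, ‖h n x‖ₑ ^ r ∂μ) atTop (𝓝 (∫⁻ _, 0 ∂μ)) := by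
    refine tendsto_lintegral_of_dominated_convergence' (fun x => ‖g x‖ₑ ^ r)
      (fun n => (hm n).enorm.pow_const r) (fun n => ?_) ?_ ?_
    · filter_upwards [hb n] with x hx
      refine ENNReal.rpow_le_rpow ?_ hr.le
      exact enorm_le_iff_norm_le.2 (hx.trans (le_abs_self _))
    · have := lintegral_rpow_enorm_lt_top_of_eLpNorm_lt_top h0 ENNReal.ofReal_ne_top hg.2
      rw [ENNReal.toReal_ofReal hr.le] at this
      exact this.ne
    · filter_upwards [hl] with x hx
      have := (hx.enorm).ennrpow_const r
      simpa [ENNReal.zero_rpow_of_pos hr] using this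
  have := key.ennrpow_const (1 / r)
  simpa [hr] using this

/-! ### The space `D^{1,p}(Ω)` -/

section
variable {N : ℕ} {p : ℝ} {Ω : Set (EuclideanSpace ℝ (Fin N))}

theorem sobolevExponent_pos (hp : 1 < p) (hpN : p < N) : 0 < sobolevExponent N p :=
  div_pos (mul_pos (by linarith) (by linarith)) (by linarith)

theorem one_le_sobolevExponent (hp : 1 < p) (hpN : p < N) : 1 ≤ sobolevExponent N p := by
  rw [sobolevExponent, le_div_iff₀ (by linarith)]
  nlinarith

theorem norm_gradient_eq (φ : EuclideanSpace ℝ (Fin N) → ℝ) (x : EuclideanSpace ℝ (Fin N)) :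
    ‖gradient φ x‖ = ‖fderiv ℝ φ x‖ := by
  rw [gradient, LinearIsometryEquiv.norm_map]

theorem IsTestFunction.continuous_gradient {φ : EuclideanSpace ℝ (Fin N) → ℝ}
    (hφ : IsTestFunction Ω φ) : Continuous (gradient φ) :=
  (LinearIsometryEquiv.continuous _).comp (hφ.1.continuous_fderiv (by simp))

theorem IsTestFunction.differentiable {φ : EuclideanSpace ℝ (Fin N) → ℝ}
    (hφ : IsTestFunction Ω φ) : Differentiable ℝ φ :=
  hφ.1.differentiable (by simp)

/-- The Sobolev inequality for test functions. -/
theorem IsTestFunction.eLpNorm_le (hp : 1 < p) (hpN : p < N)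
    {φ : EuclideanSpace ℝ (Fin N) → ℝ} (hφ : IsTestFunction Ω φ) :
    eLpNorm φ (ENNReal.ofReal (sobolevExponent N p)) (volume.restrict Ω) ≤
      SNormLESNormFDerivOfEqConst ℝ (volume : Measure (EuclideanSpace ℝ (Fin N))) p *
        eLpNorm (gradient φ) (ENNReal.ofReal p) (volume.restrict Ω) := by
  have hsupp : Function.support (gradient φ) ⊆ Ω := by
    refine Set.Subset.trans ?_ hφ.2.2
    refine Set.Subset.trans ?_ (support_fderiv_subset ℝ (f := φ))
    intro x hx h
    apply hx
    have := norm_gradient_eq φ x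
    rw [h, norm_zero, norm_eq_zero] at this
    exact this
  -- Both supports lie in `Ω`, so the inequality on the whole space applies; its exponent condition
  -- is `1/p* = 1/p - 1/N`.
  rw [eLpNorm_restrict_eq_of_support_subset ((subset_tsupport φ).trans hφ.2.2),
    eLpNorm_restrict_eq_of_support_subset hsupp]
  have h := eLpNorm_le_eLpNorm_fderiv_of_eq (volume : Measure (EuclideanSpace ℝ (Fin N)))
    (hφ.1.of_le (by simp)) hφ.2.1 (p := p.toNNReal) (p' := (sobolevExponent N p).toNNReal)
    (by rw [Real.one_le_toNNReal]; exact hp.le)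
    (by rw [finrank_euclideanSpace_fin]; exact_mod_cast (by linarith : (0 : ℝ) < N))
    (by
      rw [Real.coe_toNNReal _ (sobolevExponent_pos hp hpN).le, NNReal.coe_inv,
        Real.coe_toNNReal _ (by linarith),
        finrank_euclideanSpace_fin, sobolevExponent]
      have : (N : ℝ) - p ≠ 0 := by linarith
      have : (N : ℝ) ≠ 0 := by linarith
      have : p ≠ 0 := by linarith
      field_simp)
  rw [Real.coe_toNNReal _ (by linarith)] at h
  refine h.trans (le_of_eq ?_)
  congr 1
  exact eLpNorm_congr_norm_ae (Eventually.of_forall fun x => (norm_gradient_eq φ x).symm)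

/-- The Sobolev inequality on `D^{1,p}(Ω)`. -/
theorem MemD1p.eLpNorm_le (hp : 1 < p) (hpN : p < N)
    {u : EuclideanSpace ℝ (Fin N) → ℝ}
    {G : EuclideanSpace ℝ (Fin N) → EuclideanSpace ℝ (Fin N)} (hu : MemD1p p Ω u G) :
    eLpNorm u (ENNReal.ofReal (sobolevExponent N p)) (volume.restrict Ω) ≤
      SNormLESNormFDerivOfEqConst ℝ (volume : Measure (EuclideanSpace ℝ (Fin N))) p *
        eLpNorm G (ENNReal.ofReal p) (volume.restrict Ω) := by
  obtain ⟨hu1, hG, φ, hφ, h1, h2⟩ := hu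
  set S := SNormLESNormFDerivOfEqConst ℝ (volume : Measure (EuclideanSpace ℝ (Fin N))) p
  have hp1 : (1 : ℝ≥0∞) ≤ ENNReal.ofReal p := by simpa using hp.le
  have hps : (1 : ℝ≥0∞) ≤ ENNReal.ofReal (sobolevExponent N p) := by
    simpa using one_le_sobolevExponent hp hpN
  have bound : ∀ n, eLpNorm u (ENNReal.ofReal (sobolevExponent N p)) (volume.restrict Ω) ≤
      eLpNorm (fun x => φ n x - u x) (ENNReal.ofReal (sobolevExponent N p)) (volume.restrict Ω) +
      S * (eLpNorm (fun x => gradient (φ n) x - G x) (ENNReal.ofReal p) (volume.restrict Ω) +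
        eLpNorm G (ENNReal.ofReal p) (volume.restrict Ω)) := by
    intro n
    have mφ : AEStronglyMeasurable (φ n) (volume.restrict Ω) :=
      (hφ n).1.continuous.aestronglyMeasurable
    have mg : AEStronglyMeasurable (gradient (φ n)) (volume.restrict Ω) :=
      (hφ n).continuous_gradient.aestronglyMeasurable
    have e1 : u = (fun x => u x - φ n x) + φ n := by ext x; simp
    have e2 : gradient (φ n) = (fun x => gradient (φ n) x - G x) + G := by ext x; simp
    calc eLpNorm u (ENNReal.ofReal (sobolevExponent N p)) (volume.restrict Ω)
        ≤ eLpNorm (fun x => u x - φ n x) (ENNReal.ofReal (sobolevExponent N p))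
            (volume.restrict Ω) +
          eLpNorm (φ n) (ENNReal.ofReal (sobolevExponent N p)) (volume.restrict Ω) := by
          conv_lhs => rw [e1]
          exact eLpNorm_add_le (hu1.1.sub mφ) mφ hps
      _ ≤ _ := by
          refine add_le_add (le_of_eq ?_) (((hφ n).eLpNorm_le hp hpN).trans ?_)
          · exact eLpNorm_congr_norm_ae (Eventually.of_forall fun x => norm_sub_rev _ _)
          · gcongr
            conv_lhs => rw [e2]
            exact eLpNorm_add_le (mg.sub hG.1) hG.1 hp1
  have lim : Tendsto (fun n =>
      eLpNorm (fun x => φ n x - u x) (ENNReal.ofReal (sobolevExponent N p)) (volume.restrict Ω) +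
      S * (eLpNorm (fun x => gradient (φ n) x - G x) (ENNReal.ofReal p) (volume.restrict Ω) +
        eLpNorm G (ENNReal.ofReal p) (volume.restrict Ω))) atTop
      (𝓝 (0 + S * (0 + eLpNorm G (ENNReal.ofReal p) (volume.restrict Ω)))) :=
    h2.add (ENNReal.Tendsto.const_mul (h1.add tendsto_const_nhds) (Or.inr ENNReal.coe_ne_top))
  have := ge_of_tendsto' lim bound
  simpa using this

/-- `D^{1,p}(Ω)` is closed under limits in `L^{p*} × L^p`. -/
theorem MemD1p.of_tendsto (hp : 1 < p) (hpN : p < N)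
    {u : EuclideanSpace ℝ (Fin N) → ℝ}
    {G : EuclideanSpace ℝ (Fin N) → EuclideanSpace ℝ (Fin N)}
    {v : ℕ → EuclideanSpace ℝ (Fin N) → ℝ}
    {H : ℕ → EuclideanSpace ℝ (Fin N) → EuclideanSpace ℝ (Fin N)}
    (hu : MemLp u (ENNReal.ofReal (sobolevExponent N p)) (volume.restrict Ω))
    (hG : MemLp G (ENNReal.ofReal p) (volume.restrict Ω))
    (hv : ∀ n, MemD1p p Ω (v n) (H n))
    (hH : Tendsto (fun n => eLpNorm (fun x => H n x - G x)
      (ENNReal.ofReal p) (volume.restrict Ω)) atTop (𝓝 0))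
    (hvu : Tendsto (fun n => eLpNorm (fun x => v n x - u x)
      (ENNReal.ofReal (sobolevExponent N p)) (volume.restrict Ω)) atTop (𝓝 0)) :
    MemD1p p Ω u G := by
  have hp1 : (1 : ℝ≥0∞) ≤ ENNReal.ofReal p := by simpa using hp.le
  have hps : (1 : ℝ≥0∞) ≤ ENNReal.ofReal (sobolevExponent N p) := by
    simpa using one_le_sobolevExponent hp hpN
  -- Diagonal choice: a test function within `1/(n+1)` of `(v n, H n)` in both norms.
  have key : ∀ n : ℕ, ∃ φ, IsTestFunction Ω φ ∧
      eLpNorm (fun x => gradient φ x - H n x) (ENNReal.ofReal p) (volume.restrict Ω) ≤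
        ((n : ℝ≥0∞) + 1)⁻¹ ∧
      eLpNorm (fun x => φ x - v n x) (ENNReal.ofReal (sobolevExponent N p))
        (volume.restrict Ω) ≤ ((n : ℝ≥0∞) + 1)⁻¹ := by
    intro n
    obtain ⟨-, -, φ, hφ, h1, h2⟩ := hv n
    have hpos : (0 : ℝ≥0∞) < ((n : ℝ≥0∞) + 1)⁻¹ := by simp
    obtain ⟨m, hm1, hm2⟩ := ((h1.eventually_le_const hpos).and (h2.eventually_le_const hpos)).exists
    exact ⟨φ m, hφ m, hm1, hm2⟩
  choose φ hφ h1 h2 using key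
  have hinv : Tendsto (fun n : ℕ => ((n : ℝ≥0∞) + 1)⁻¹) atTop (𝓝 0) := by
    have := (tendsto_add_atTop_iff_nat 1).2 ENNReal.tendsto_inv_nat_nhds_zero
    simpa using this
  refine ⟨hu, hG, φ, hφ, ?_, ?_⟩
  · refine tendsto_of_tendsto_of_tendsto_of_le_of_le tendsto_const_nhds
      (by simpa using hinv.add hH) (fun _ => zero_le) (fun n => ?_)
    have e : (fun x => gradient (φ n) x - G x) =
        (fun x => gradient (φ n) x - H n x) + fun x => H n x - G x := by ext x; simp
    dsimp only
    rw [e]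
    exact (eLpNorm_add_le ((hφ n).continuous_gradient.aestronglyMeasurable.sub (hv n).2.1.1)
      ((hv n).2.1.1.sub hG.1) hp1).trans (add_le_add (h1 n) le_rfl)
  · refine tendsto_of_tendsto_of_tendsto_of_le_of_le tendsto_const_nhds
      (by simpa using hinv.add hvu) (fun _ => zero_le) (fun n => ?_)
    have e : (fun x => φ n x - u x) =
        (fun x => φ n x - v n x) + fun x => v n x - u x := by ext x; simp
    dsimp only
    rw [e]
    exact (eLpNorm_add_le ((hφ n).1.continuous.aestronglyMeasurable.sub (hv n).1.1)
      ((hv n).1.1.sub hu.1) hps).trans (add_le_add (h2 n) le_rfl)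

theorem gradient_comp_real {f : ℝ → ℝ} {φ : EuclideanSpace ℝ (Fin N) → ℝ}
    {x : EuclideanSpace ℝ (Fin N)} (hf : DifferentiableAt ℝ f (φ x))
    (hφ : DifferentiableAt ℝ φ x) :
    gradient (f ∘ φ) x = deriv f (φ x) • gradient φ x := by
  have h := hf.hasDerivAt.comp_hasFDerivAt x hφ.hasFDerivAt
  rw [gradient, gradient, h.fderiv, map_smulₛₗ]
  simp

theorem IsTestFunction.comp {f : ℝ → ℝ} (hf : ContDiff ℝ ∞ f) (h0 : f 0 = 0)
    {φ : EuclideanSpace ℝ (Fin N) → ℝ} (hφ : IsTestFunction Ω φ) : IsTestFunction Ω (f ∘ φ) :=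
  ⟨hf.comp hφ.1, hφ.2.1.comp_left h0, (tsupport_comp_subset h0 φ).trans hφ.2.2⟩

/-- The chain rule in `D^{1,p}(Ω)`. -/
theorem MemD1p.comp (hp : 1 < p) (hpN : p < N) {f : ℝ → ℝ} (hf : ContDiff ℝ ∞ f) (h0 : f 0 = 0)
    {L : ℝ} (hL : ∀ s, |deriv f s| ≤ L) {u : EuclideanSpace ℝ (Fin N) → ℝ}
    {G : EuclideanSpace ℝ (Fin N) → EuclideanSpace ℝ (Fin N)} (hu : MemD1p p Ω u G) :
    MemD1p p Ω (fun x => f (u x)) (fun x => deriv f (u x) • G x) := by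
  have hp0 : 0 < p := by linarith
  have hp1 : (1 : ℝ≥0∞) ≤ ENNReal.ofReal p := by simpa using hp.le
  have hps0 := sobolevExponent_pos hp hpN
  obtain ⟨hu1, hG, φ, hφ, h1, h2⟩ := hu
  have hfd : Differentiable ℝ f := hf.differentiable (by simp)
  have hdc : Continuous (deriv f) := hf.continuous_deriv (by simp)
  have hL0 : 0 ≤ L := (abs_nonneg _).trans (hL 0)
  have hlip : ∀ a b, |f a - f b| ≤ L * |a - b| := fun a b =>
    Convex.norm_image_sub_le_of_norm_deriv_le (f := f) (s := Set.univ) (C := L)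
      (fun x _ => hfd x) (fun x _ => hL x) convex_univ trivial trivial
  have mfu : AEStronglyMeasurable (fun x => f (u x)) (volume.restrict Ω) :=
    hf.continuous.comp_aestronglyMeasurable hu1.1
  have mdu : AEStronglyMeasurable (fun x => deriv f (u x)) (volume.restrict Ω) :=
    hdc.comp_aestronglyMeasurable hu1.1
  have mφ : ∀ n, AEStronglyMeasurable (φ n) (volume.restrict Ω) := fun n =>
    (hφ n).1.continuous.aestronglyMeasurable
  have mg : ∀ n, AEStronglyMeasurable (gradient (φ n)) (volume.restrict Ω) := fun n =>
    (hφ n).continuous_gradient.aestronglyMeasurable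
  have mdφ : ∀ n, AEStronglyMeasurable (fun x => deriv f (φ n x)) (volume.restrict Ω) := fun n =>
    hdc.comp_aestronglyMeasurable (mφ n)
  -- The factor `deriv f` is merely continuous and bounded, so `deriv f (φ n) → deriv f u` is
  -- obtained pointwise a.e. along a subsequence.
  obtain ⟨ns, hns, hae⟩ := (tendstoInMeasure_of_tendsto_eLpNorm
    (by simpa using hps0) mφ hu1.1 h2).exists_seq_tendsto_ae
  refine ⟨?_, ?_, fun n => f ∘ φ (ns n), fun n => (hφ (ns n)).comp hf h0, ?_, ?_⟩
  · refine MemLp.of_le_mul (c := L) hu1 mfu (Eventually.of_forall fun x => ?_)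
    simpa [h0] using hlip (u x) 0
  · refine MemLp.of_le_mul (c := L) hG (mdu.smul hG.1) (Eventually.of_forall fun x => ?_)
    rw [norm_smul]
    exact mul_le_mul_of_nonneg_right (hL _) (norm_nonneg _)
  · have hdom : Tendsto (fun n => eLpNorm (fun x => (deriv f (φ (ns n) x) - deriv f (u x)) • G x)
        (ENNReal.ofReal p) (volume.restrict Ω)) atTop (𝓝 0) := by
      refine tendsto_eLpNorm_zero_of_dominated hp0 (g := fun x => (2 * L) * ‖G x‖)
        (fun n => ((mdφ (ns n)).sub mdu).smul hG.1) (hG.norm.const_mul _)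
        (fun n => Eventually.of_forall fun x => ?_) ?_
      · rw [norm_smul]
        refine mul_le_mul_of_nonneg_right ?_ (norm_nonneg _)
        refine (norm_sub_le _ _).trans ?_
        have a := hL (φ (ns n) x)
        have b := hL (u x)
        simp only [Real.norm_eq_abs]
        linarith
      · filter_upwards [hae] with x hx
        have := (((hdc.tendsto (u x)).comp hx).sub_const (deriv f (u x))).smul_const (G x)
        simpa using this
    have hone : Tendsto (fun n => ENNReal.ofReal L * eLpNorm
        (fun x => gradient (φ (ns n)) x - G x) (ENNReal.ofReal p) (volume.restrict Ω))
        atTop (𝓝 0) := by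
      have := ENNReal.Tendsto.const_mul (a := ENNReal.ofReal L) (h1.comp hns.tendsto_atTop)
        (Or.inr ENNReal.ofReal_ne_top)
      simpa using this
    refine tendsto_of_tendsto_of_tendsto_of_le_of_le tendsto_const_nhds
      (by simpa using hone.add hdom) (fun _ => zero_le) (fun n => ?_)
    -- The first summand is at most `L |∇φ - G|`; the second tends to zero by dominated convergence,
    -- with majorant `2L |G|`.
    have e : (fun x => gradient (f ∘ φ (ns n)) x - deriv f (u x) • G x) =
        (fun x => deriv f (φ (ns n) x) • (gradient (φ (ns n)) x - G x)) +
          fun x => (deriv f (φ (ns n) x) - deriv f (u x)) • G x := by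
      ext1 x
      rw [gradient_comp_real (hfd _) ((hφ (ns n)).differentiable x)]
      simp only [Pi.add_apply, smul_sub, sub_smul]
      abel
    dsimp only
    rw [e]
    refine (eLpNorm_add_le ((mdφ _).smul ((mg _).sub hG.1))
      (((mdφ _).sub mdu).smul hG.1) hp1).trans (add_le_add ?_ le_rfl)
    refine eLpNorm_le_mul_eLpNorm_of_ae_le_mul (Eventually.of_forall fun x => ?_) _
    refine (norm_smul (deriv f (φ (ns n) x)) (gradient (φ (ns n)) x - G x)).trans_le ?_
    exact mul_le_mul_of_nonneg_right (hL _) (norm_nonneg _)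
  · have hone : Tendsto (fun n => ENNReal.ofReal L * eLpNorm
        (fun x => φ (ns n) x - u x) (ENNReal.ofReal (sobolevExponent N p)) (volume.restrict Ω))
        atTop (𝓝 0) := by
      have := ENNReal.Tendsto.const_mul (a := ENNReal.ofReal L) (h2.comp hns.tendsto_atTop)
        (Or.inr ENNReal.ofReal_ne_top)
      simpa using this
    refine tendsto_of_tendsto_of_tendsto_of_le_of_le tendsto_const_nhds
      hone (fun _ => zero_le) (fun n => ?_)
    exact eLpNorm_le_mul_eLpNorm_of_ae_le_mul (Eventually.of_forall fun x => hlip _ _) _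

/-- Truncations `(-u - k)⁺` of functions in `D^{1,p}(Ω)` are again in `D^{1,p}(Ω)`. -/
theorem MemD1p.truncation (hp : 1 < p) (hpN : p < N) {k : ℝ} (hk : 0 ≤ k)
    {u : EuclideanSpace ℝ (Fin N) → ℝ}
    {G : EuclideanSpace ℝ (Fin N) → EuclideanSpace ℝ (Fin N)} (hu : MemD1p p Ω u G) :
    MemD1p p Ω (fun x => max (-u x - k) 0) ({x | u x < -k}.indicator fun x => -G x) := by
  have hp0 : 0 < p := by linarith
  have hps0 := sobolevExponent_pos hp hpN
  obtain ⟨L, hL⟩ := exists_abs_deriv_smoothPos_le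
  have hL0 : 0 ≤ L := (abs_nonneg _).trans (hL 0)
  have hu1 := hu.1
  have hG := hu.2.1
  have hE : NullMeasurableSet {x | u x < -k} (volume.restrict Ω) :=
    nullMeasurableSet_lt hu1.1.aemeasurable aemeasurable_const
  have mw : AEStronglyMeasurable (fun x => max (-u x - k) 0) (volume.restrict Ω) :=
    (hu1.1.neg.sub aestronglyMeasurable_const).sup aestronglyMeasurable_const
  have hwle : ∀ x, max (-u x - k) 0 ≤ |u x| := fun x =>
    max_le (by linarith [neg_le_abs (u x)]) (abs_nonneg _)
  have hw : MemLp (fun x => max (-u x - k) 0) (ENNReal.ofReal (sobolevExponent N p))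
      (volume.restrict Ω) := by
    refine hu1.of_le mw (Eventually.of_forall fun x => ?_)
    rw [Real.norm_of_nonneg (le_max_right _ _)]
    exact hwle x
  have hDw : MemLp ({x | u x < -k}.indicator fun x => -G x) (ENNReal.ofReal p)
      (volume.restrict Ω) := by
    refine hG.of_le (hG.1.neg.indicator₀ hE) (Eventually.of_forall fun x => ?_)
    refine (norm_indicator_le_norm_self _ _).trans (by simp)
  -- This rescaling keeps the derivatives bounded by `L` uniformly in `n`, and at each fixed `s`
  -- both `f n s` and its derivative eventually equal their limits. The condition `k ≥ 0` ensures `f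
  -- n 0 = 0`.
  set f : ℕ → ℝ → ℝ := fun n s => ((n : ℝ) + 1)⁻¹ * smoothPos (((n : ℝ) + 1) * (-s - k)) with hf
  have hfc : ∀ n, ContDiff ℝ ∞ (f n) := fun n =>
    contDiff_const.mul (contDiff_smoothPos.comp
      (contDiff_const.mul (contDiff_id.neg.sub contDiff_const)))
  have hfd : ∀ n s, deriv (f n) s = -deriv smoothPos (((n : ℝ) + 1) * (-s - k)) := by
    intro n s
    have h1 : HasDerivAt (fun s : ℝ => ((n : ℝ) + 1) * (-s - k)) (((n : ℝ) + 1) * (-1)) s :=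
      (((hasDerivAt_id s).neg).sub_const k).const_mul _
    have h2 := ((differentiable_smoothPos (((n : ℝ) + 1) * (-s - k))).hasDerivAt.comp s h1).const_mul
      ((n : ℝ) + 1)⁻¹
    have h3 : HasDerivAt (f n) _ s := h2
    rw [h3.deriv]
    have : (n : ℝ) + 1 ≠ 0 := by positivity
    field_simp
  have hfl : ∀ n s, |f n s| ≤ max (-s - k) 0 := by
    intro n s
    have hn : (0 : ℝ) < (n : ℝ) + 1 := by positivity
    simp only [hf]
    rw [abs_mul, abs_of_pos (inv_pos.2 hn), inv_mul_le_iff₀ hn, mul_max_of_nonneg _ _ hn.le,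
      mul_zero]
    exact abs_smoothPos_le _
  have hev : ∀ s : ℝ, s < -k → ∀ᶠ n : ℕ in atTop, 1 < ((n : ℝ) + 1) * (-s - k) := by
    intro s hs
    have hs' : 0 < -s - k := by linarith
    obtain ⟨m, hm⟩ := exists_nat_gt (1 / (-s - k))
    filter_upwards [eventually_ge_atTop m] with n hn
    rw [div_lt_iff₀ hs'] at hm
    have : (m : ℝ) ≤ n := by exact_mod_cast hn
    nlinarith
  have hcomp : ∀ n, MemD1p p Ω (fun x => f n (u x)) (fun x => deriv (f n) (u x) • G x) := by
    intro n
    refine MemD1p.comp hp hpN (hfc n) ?_ (L := L) (fun s => ?_) hu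
    · have h : ((n : ℝ) + 1) * (-0 - k) ≤ 0 := by
        have : (0 : ℝ) < (n : ℝ) + 1 := by positivity
        nlinarith
      simp only [hf, smoothPos_of_nonpos h, mul_zero]
    · rw [hfd, abs_neg]; exact hL _
  refine MemD1p.of_tendsto hp hpN hw hDw hcomp ?_ ?_
  · refine tendsto_eLpNorm_zero_of_dominated hp0 (g := fun x => (L + 1) * ‖G x‖)
        (fun n => (hcomp n).2.1.1.sub hDw.1) (hG.norm.const_mul _)
        (fun n => Eventually.of_forall fun x => ?_) (Eventually.of_forall fun x => ?_)
    · refine (norm_sub_le _ _).trans ?_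
      rw [add_mul, one_mul, norm_smul]
      refine add_le_add (mul_le_mul_of_nonneg_right ?_ (norm_nonneg _)) ?_
      · rw [hfd, norm_neg]; exact hL _
      · exact (norm_indicator_le_norm_self _ _).trans (by simp)
    · refine tendsto_const_nhds.congr' ?_
      by_cases hx : u x < -k
      · filter_upwards [hev _ hx] with n hn
        rw [Set.indicator_of_mem (by exact hx), hfd, deriv_smoothPos_of_one_lt hn]
        simp
      · refine Eventually.of_forall fun n => ?_
        have h : ((n : ℝ) + 1) * (-u x - k) ≤ 0 := by
          have : (0 : ℝ) < (n : ℝ) + 1 := by positivity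
          push Not at hx
          nlinarith
        beta_reduce
        rw [Set.indicator_of_notMem (by exact hx), hfd, deriv_smoothPos_of_nonpos h]
        simp
  · refine tendsto_eLpNorm_zero_of_dominated hps0 (g := fun x => 2 * ‖u x‖)
        (fun n => (hcomp n).1.1.sub hw.1) (hu1.norm.const_mul _)
        (fun n => Eventually.of_forall fun x => ?_) (Eventually.of_forall fun x => ?_)
    · refine (norm_sub_le _ _).trans ?_
      have a := hfl n (u x)
      have b := hwle x
      rw [Real.norm_of_nonneg (le_max_right (-u x - k) 0), Real.norm_eq_abs, Real.norm_eq_abs]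
      linarith
    · refine tendsto_const_nhds.congr' ?_
      by_cases hx : u x < -k
      · filter_upwards [hev _ hx] with n hn
        have hn0 : (n : ℝ) + 1 ≠ 0 := by positivity
        simp only [hf]
        rw [smoothPos_of_one_le hn.le, max_eq_left (by linarith), ← mul_assoc,
          inv_mul_cancel₀ hn0, one_mul, sub_self]
      · refine Eventually.of_forall fun n => ?_
        have hx' : -u x - k ≤ 0 := by push Not at hx; linarith
        have h : ((n : ℝ) + 1) * (-u x - k) ≤ 0 := by
          have : (0 : ℝ) < (n : ℝ) + 1 := by positivity
          nlinarith
        simp only [hf]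
        rw [smoothPos_of_nonpos h, max_eq_right hx']
        simp

end

/-! ### The energy estimate on superlevel sets of `-u` -/

/-- No sharp constant is needed: according to whether `K w ≤ l s` or not, one of the two terms on
the right already dominates. -/
theorem mul_rpow_mul_le_young {p K l s w : ℝ} (hp : 1 < p) (hK : 0 ≤ K) (hl : 0 < l) (hs : 0 ≤ s)
    (hw : 0 ≤ w) :
    K * s ^ (p - 1) * w ≤ l * s ^ p + K * (K / l) ^ (p - 1) * w ^ p := by
  have hpow : ∀ x : ℝ, 0 ≤ x → x ^ (p - 1) * x = x ^ p := fun x hx => by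
    conv_lhs => rw [← Real.rpow_add_one' hx (by linarith)]
    ring_nf
  have h2 : 0 ≤ K * (K / l) ^ (p - 1) * w ^ p := by positivity
  have h3 : 0 ≤ l * s ^ p := by positivity
  rcases le_total (K * w) (l * s) with h | h
  · calc K * s ^ (p - 1) * w = s ^ (p - 1) * (K * w) := by ring
      _ ≤ s ^ (p - 1) * (l * s) := by gcongr
      _ = l * s ^ p := by rw [← hpow s hs]; ring
      _ ≤ _ := by linarith
  · have hs' : s ≤ K / l * w := by
      rw [div_mul_eq_mul_div, le_div_iff₀ hl]; linarith
    calc K * s ^ (p - 1) * w ≤ K * (K / l * w) ^ (p - 1) * w := by gcongr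
      _ = K * (K / l) ^ (p - 1) * w ^ p := by
        rw [Real.mul_rpow (by positivity) hw, ← hpow w hw]; ring
      _ ≤ _ := by linarith

theorem add_rpow_le_two_rpow_mul {p a b : ℝ} (hp : 0 ≤ p) (ha : 0 ≤ a) (hb : 0 ≤ b) :
    (a + b) ^ p ≤ 2 ^ p * (a ^ p + b ^ p) := by
  have ha' := Real.rpow_nonneg ha p
  have hb' := Real.rpow_nonneg hb p
  rcases le_total a b with h | h
  · calc (a + b) ^ p ≤ (2 * b) ^ p := by gcongr; linarith
      _ = 2 ^ p * b ^ p := Real.mul_rpow (by norm_num) hb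
      _ ≤ _ := by gcongr; linarith
  · calc (a + b) ^ p ≤ (2 * a) ^ p := by gcongr; linarith
      _ = 2 ^ p * a ^ p := Real.mul_rpow (by norm_num) ha
      _ ≤ _ := by gcongr; linarith

/-- The constant in the energy estimate. -/
noncomputable def energyConst (p lam K : ℝ) : ℝ :=
  2 ^ p + 2 * K + K * (K / (lam / 2)) ^ (p - 1)

/-- The pointwise form of the energy estimate: `s = |∇u|`, `a = A(x,u,∇u)·∇u`, `b = B(x,u,∇u)`,
`w = -u - k`. -/
theorem structure_pointwise {p lam K a₁ a₂ b₁ b₂ b₃ s w k a b : ℝ} (hp : 1 < p) (hlam : 0 < lam)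
    (hs : 0 ≤ s) (hw : 0 ≤ w) (hk : 0 ≤ k)
    (ha₁ : 0 ≤ a₁) (hb₁ : 0 ≤ b₁) (hb₂ : 0 ≤ b₂)
    (ha₂K : a₂ ≤ K) (hb₁K : b₁ ≤ K) (hb₃K : b₃ ≤ K)
    (hA : lam * s ^ p - a₁ * (w + k) ^ p - a₂ ≤ a)
    (hB : |b| ≤ b₁ * s ^ (p - 1) + b₂ * (w + k) ^ (p - 1) + b₃) :
    lam / 2 * s ^ p ≤ (a + b * w) +
      energyConst p lam K * ((a₁ + b₂) * (w ^ p + k ^ p) + (w ^ p + 1)) := by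
  have hK : 0 ≤ K := hb₁.trans hb₁K
  have hwp := Real.rpow_nonneg hw p
  have hkp := Real.rpow_nonneg hk p
  have hwk : (w + k) ^ (p - 1) * (w + k) = (w + k) ^ p := by
    rw [← Real.rpow_add_one' (by positivity) (by linarith)]; ring_nf
  have e1 : -(b * w) ≤ (b₁ * s ^ (p - 1) + b₂ * (w + k) ^ (p - 1) + b₃) * w := by
    have := mul_le_mul_of_nonneg_right ((neg_le_abs b).trans hB) hw
    linarith
  have e2 : b₁ * s ^ (p - 1) * w ≤ K * s ^ (p - 1) * w := by gcongr
  have e3 := mul_rpow_mul_le_young hp hK (half_pos hlam) hs hw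
  have e4 : b₂ * (w + k) ^ (p - 1) * w ≤ b₂ * (w + k) ^ p := by
    rw [← hwk, ← mul_assoc]
    gcongr
    linarith
  have e5 : b₃ * w ≤ K * (w ^ p + 1) := by
    have : w ≤ w ^ p + 1 := by
      rcases le_total w 1 with h | h
      · linarith
      · have := Real.self_le_rpow_of_one_le h hp.le
        linarith
    exact (mul_le_mul_of_nonneg_right hb₃K hw).trans (mul_le_mul_of_nonneg_left this hK)
  have e6 : (a₁ + b₂) * (w + k) ^ p ≤ (a₁ + b₂) * (2 ^ p * (w ^ p + k ^ p)) := by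
    gcongr
    exact add_rpow_le_two_rpow_mul (by linarith) hw hk
  have h2p : (0 : ℝ) ≤ 2 ^ p := by positivity
  have hc : 0 ≤ K * (K / (lam / 2)) ^ (p - 1) := by positivity
  have f1 : 0 ≤ (2 * K + K * (K / (lam / 2)) ^ (p - 1)) * ((a₁ + b₂) * (w ^ p + k ^ p)) := by
    positivity
  have f2 : 0 ≤ 2 ^ p * (w ^ p + 1) := by positivity
  have f3 : 0 ≤ K * w ^ p := by positivity
  -- The summand `2 ^ p` pays for splitting `(w + k)^p`, `2 * K` for `a₂` and `b₃ w`, and the last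
  -- one for Young's inequality with `l = λ/2`.
  rw [energyConst]
  nlinarith

/-- If the right side is infinite there is nothing to prove; otherwise `r` is integrable and the
pointwise bound can be integrated. The tested inequality can thus be used without first knowing that
the lower order terms are integrable. -/
theorem lintegral_ofReal_le_of_le_add {α : Type*} [MeasurableSpace α] {μ : Measure α}
    {f g r : α → ℝ} (hg : Integrable g μ) (hg0 : ∫ x, g x ∂μ ≤ 0) (hr : AEMeasurable r μ)
    (hr0 : ∀ᵐ x ∂μ, 0 ≤ r x) (hf0 : ∀ᵐ x ∂μ, 0 ≤ f x) (h : ∀ᵐ x ∂μ, f x ≤ g x + r x) :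
    ∫⁻ x, ENNReal.ofReal (f x) ∂μ ≤ ∫⁻ x, ENNReal.ofReal (r x) ∂μ := by
  by_cases htop : ∫⁻ x, ENNReal.ofReal (r x) ∂μ = ⊤
  · rw [htop]; exact le_top
  have hri : Integrable r μ :=
    (lintegral_ofReal_ne_top_iff_integrable hr.aestronglyMeasurable hr0).1 htop
  calc ∫⁻ x, ENNReal.ofReal (f x) ∂μ ≤ ∫⁻ x, ENNReal.ofReal (g x + r x) ∂μ :=
        lintegral_mono_ae (h.mono fun x hx => ENNReal.ofReal_le_ofReal hx)
    _ = ENNReal.ofReal (∫ x, (g x + r x) ∂μ) := by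
        refine (ofReal_integral_eq_lintegral_ofReal (hg.add hri) ?_).symm
        filter_upwards [h, hf0] with x hx hx0 using hx0.trans hx
    _ ≤ ENNReal.ofReal (∫ x, r x ∂μ) := by
        refine ENNReal.ofReal_le_ofReal ?_
        rw [integral_add hg hri]; linarith
    _ = _ := ofReal_integral_eq_lintegral_ofReal hri hr0

/-- Hölder's inequality with three factors, the last one an indicator function. -/
theorem setLIntegral_rpow_mul_rpow_le {α : Type*} [MeasurableSpace α] {μ : Measure α}
    {f g : α → ℝ≥0∞} (hf : AEMeasurable f μ) (hg : AEMeasurable g μ) (E : Set α) {a b c : ℝ}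
    (ha : 0 ≤ a) (hb : 0 ≤ b) (hc : 0 ≤ c) (habc : a + b + c = 1) :
    ∫⁻ x in E, f x ^ a * g x ^ b ∂μ ≤ (∫⁻ x, f x ∂μ) ^ a * (∫⁻ x, g x ∂μ) ^ b * μ E ^ c := by
  have h : ∫⁻ x in E, f x ^ a * g x ^ b * 1 ^ c ∂μ ≤
      (∫⁻ x in E, f x ∂μ) ^ a * (∫⁻ x in E, g x ∂μ) ^ b * (∫⁻ _ in E, 1 ∂μ) ^ c := by
    have h₀ := ENNReal.lintegral_prod_norm_pow_le (μ := μ.restrict E) Finset.univ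
        (f := ![f, g, fun _ => 1]) (p := ![a, b, c])
        (by intro i _; fin_cases i <;> simp [hf.restrict, hg.restrict])
        (by simp [Fin.sum_univ_three, habc])
        (by intro i _; fin_cases i <;> simp [ha, hb, hc])
    simp only [Fin.prod_univ_three] at h₀
    exact h₀
  simp only [ENNReal.one_rpow, mul_one, lintegral_one, Measure.restrict_apply_univ] at h
  refine h.trans ?_
  gcongr <;> exact Measure.restrict_le_self

section
variable {N : ℕ} {p : ℝ} {Ω : Set (EuclideanSpace ℝ (Fin N))}
  {A : EuclideanSpace ℝ (Fin N) → ℝ → EuclideanSpace ℝ (Fin N) → EuclideanSpace ℝ (Fin N)}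
  {B : EuclideanSpace ℝ (Fin N) → ℝ → EuclideanSpace ℝ (Fin N) → ℝ}
  {a₁ a₂ b₁ b₂ b₃ u : EuclideanSpace ℝ (Fin N) → ℝ}
  {Du : EuclideanSpace ℝ (Fin N) → EuclideanSpace ℝ (Fin N)}

/-- The Caccioppoli inequality on the set `{-u > k}`. -/
theorem IsWeakSupersolution.energy_le {lam K k : ℝ} (hp : 1 < p) (hpN : p < N) (hlam : 0 < lam)
    (hK : 0 ≤ K) (hk : 0 ≤ k)
    (hpos : ∀ᵐ x ∂(volume.restrict Ω), 0 ≤ a₁ x ∧ 0 ≤ b₁ x ∧ 0 ≤ b₂ x)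
    (hbd : ∀ᵐ x ∂(volume.restrict Ω), a₂ x ≤ K ∧ b₁ x ≤ K ∧ b₃ x ≤ K)
    (ha₁ : AEMeasurable a₁ (volume.restrict Ω)) (hb₂ : AEMeasurable b₂ (volume.restrict Ω))
    (hA : StructureCondA p lam Ω A a₁ a₂) (hB : StructureCondB p Ω B b₁ b₂ b₃)
    (hu : IsWeakSupersolution p Ω A B u Du) :
    ENNReal.ofReal (lam / 2) *
        ∫⁻ x in Ω, ‖({x | u x < -k}.indicator fun x => -Du x) x‖ₑ ^ p ≤
      ENNReal.ofReal (energyConst p lam K) *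
        ∫⁻ x in {x | u x < -k}, (‖a₁ x + b₂ x‖ₑ * (‖max (-u x - k) 0‖ₑ ^ p + ENNReal.ofReal (k ^ p))
          + (‖max (-u x - k) 0‖ₑ ^ p + 1)) ∂(volume.restrict Ω) := by
  have hp0 : 0 < p := by linarith
  obtain ⟨hmem, htest⟩ := hu
  set E : Set (EuclideanSpace ℝ (Fin N)) := {x | u x < -k} with hEdef
  set w : EuclideanSpace ℝ (Fin N) → ℝ := fun x => max (-u x - k) 0 with hw
  set Dw := E.indicator fun x => -Du x with hDw
  have hD0 : 0 ≤ energyConst p lam K := by unfold energyConst; positivity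
  have mu : AEMeasurable u (volume.restrict Ω) := hmem.1.1.aemeasurable
  have mw : AEMeasurable w (volume.restrict Ω) := (mu.neg.sub_const k).max aemeasurable_const
  have hE : NullMeasurableSet E (volume.restrict Ω) :=
    nullMeasurableSet_lt mu aemeasurable_const
  have hw0 : ∀ x, 0 ≤ w x := fun x => le_max_right _ _
  -- Integrability of `A · ∇w` belongs to the notion of supersolution, so no upper growth bound on
  -- `A` is required.
  obtain ⟨hi1, hi2, hle⟩ := htest w Dw (hmem.truncation hp hpN hk) (Eventually.of_forall hw0)
  set r₀ : EuclideanSpace ℝ (Fin N) → ℝ := fun x => energyConst p lam K *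
    ((a₁ x + b₂ x) * (w x ^ p + k ^ p) + (w x ^ p + 1)) with hr₀
  have mr₀ : AEMeasurable r₀ (volume.restrict Ω) :=
    (((ha₁.add hb₂).mul ((mw.pow_const p).add_const _)).add ((mw.pow_const p).add_const _)).const_mul _
  have hr₀0 : ∀ᵐ x ∂(volume.restrict Ω), 0 ≤ r₀ x := by
    filter_upwards [hpos] with x hx
    have := hx.1
    have := hx.2.2
    have := hw0 x
    positivity
  -- On `E` one has `Dw = -Du` and `|u| = w + k`, so `g = A · ∇u + B w` there; off `E` all terms
  -- vanish. The supersolution inequality says that `∫ g ≤ 0`.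
  have key := lintegral_ofReal_le_of_le_add (μ := volume.restrict Ω)
    (f := fun x => lam / 2 * ‖Dw x‖ ^ p) (r := E.indicator r₀)
    (g := fun x => B x (u x) (Du x) * w x - inner ℝ (A x (u x) (Du x)) (Dw x))
    (hi2.sub hi1) (by rw [integral_sub hi2 hi1]; linarith) (mr₀.indicator₀ hE)
    (by
      filter_upwards [hr₀0] with x hx
      exact Set.indicator_apply_nonneg fun _ => hx)
    (Eventually.of_forall fun x => by positivity) (by
      filter_upwards [hpos, hbd, hA, hB] with x h1 h2 h3 h4
      by_cases hx : x ∈ E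
      · have hx' : u x < -k := hx
        have hwx : w x = -u x - k := max_eq_left (by linarith)
        have hux : |u x| = w x + k := by rw [hwx, abs_of_neg (by linarith)]; ring_nf
        simp only [hDw, Set.indicator_of_mem hx, norm_neg, inner_neg_right, sub_neg_eq_add]
        have := structure_pointwise (a := inner ℝ (A x (u x) (Du x)) (Du x)) (b := B x (u x) (Du x))
          hp hlam (norm_nonneg (Du x)) (hw0 x) hk h1.1 h1.2.1 h1.2.2
          h2.1 h2.2.1 h2.2.2 (by rw [← hux]; exact h3 (u x) (Du x))
          (by rw [← hux]; exact h4 (u x) (Du x))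
        simp only [hr₀]
        linarith
      · have hx' : ¬ u x < -k := hx
        have hwx : w x = 0 := max_eq_right (by linarith)
        simp [hDw, Set.indicator_of_notMem hx, hwx, hp0.ne'])
  calc ENNReal.ofReal (lam / 2) * ∫⁻ x in Ω, ‖Dw x‖ₑ ^ p
      = ∫⁻ x in Ω, ENNReal.ofReal (lam / 2 * ‖Dw x‖ ^ p) := by
        rw [← lintegral_const_mul' _ _ ENNReal.ofReal_ne_top]
        refine lintegral_congr fun x => ?_
        rw [ENNReal.ofReal_mul (by positivity), ← ENNReal.ofReal_rpow_of_nonneg (norm_nonneg _) hp0.le,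
          ofReal_norm]
    _ ≤ ∫⁻ x in Ω, ENNReal.ofReal (E.indicator r₀ x) := key
    _ = ∫⁻ x in E, ENNReal.ofReal (r₀ x) ∂(volume.restrict Ω) := by
        rw [← lintegral_indicator₀ hE]
        refine lintegral_congr fun x => ?_
        by_cases hx : x ∈ E
        · simp [Set.indicator_of_mem hx]
        · simp [Set.indicator_of_notMem hx]
    _ ≤ _ := by
        rw [← lintegral_const_mul' _ _ ENNReal.ofReal_ne_top]
        refine lintegral_mono fun x => ?_
        have hwp : 0 ≤ w x ^ p := Real.rpow_nonneg (hw0 x) p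
        have hkp : 0 ≤ k ^ p := Real.rpow_nonneg hk p
        have e : ‖w x‖ₑ ^ p = ENNReal.ofReal (w x ^ p) := by
          rw [← ENNReal.ofReal_rpow_of_nonneg (hw0 x) hp0.le, Real.enorm_of_nonneg (hw0 x)]
        simp only [hr₀]
        rw [e, ENNReal.ofReal_mul hD0, ← ENNReal.ofReal_add hwp hkp, ← ENNReal.ofReal_one,
          ← ENNReal.ofReal_add hwp zero_le_one]
        gcongr
        refine ENNReal.ofReal_add_le.trans ?_
        gcongr
        rw [ENNReal.ofReal_mul' (by positivity)]
        gcongr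
        exact Real.ofReal_le_enorm _

/-- The bound for the `L^{p*}` norm of the truncations in terms of the measure of the
superlevel sets of `-u`. -/
theorem IsWeakSupersolution.eLpNorm_truncation_le {lam K q k : ℝ} (hp : 1 < p) (hpN : p < N)
    (hq : (N : ℝ) < q) (hlam : 0 < lam) (hK : 0 ≤ K) (hk : 0 ≤ k)
    (hpos : ∀ᵐ x ∂(volume.restrict Ω), 0 ≤ a₁ x ∧ 0 ≤ b₁ x ∧ 0 ≤ b₂ x)
    (hbd : ∀ᵐ x ∂(volume.restrict Ω), a₂ x ≤ K ∧ b₁ x ≤ K ∧ b₃ x ≤ K)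
    (ha₁ : AEMeasurable a₁ (volume.restrict Ω)) (hb₂ : AEMeasurable b₂ (volume.restrict Ω))
    (hab : eLpNorm (fun x => a₁ x + b₂ x) (ENNReal.ofReal (q / p)) (volume.restrict Ω) ≤
      ENNReal.ofReal K)
    (hA : StructureCondA p lam Ω A a₁ a₂) (hB : StructureCondB p Ω B b₁ b₂ b₃)
    (hu : IsWeakSupersolution p Ω A B u Du) {S m : ℝ≥0∞}
    (hS : S = eLpNorm (fun x => max (-u x - k) 0) (ENNReal.ofReal (sobolevExponent N p))
      (volume.restrict Ω) ^ p)
    (hm : m = volume.restrict Ω {x | u x < -k}) :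
    S ≤ ((SNormLESNormFDerivOfEqConst ℝ (volume : Measure (EuclideanSpace ℝ (Fin N))) p : ℝ≥0∞) ^ p
        * ENNReal.ofReal (energyConst p lam K / (lam / 2))) *
      (ENNReal.ofReal K * (S * m ^ (p / N - p / q) + ENNReal.ofReal (k ^ p) * m ^ (1 - p / q)) +
        (S * m ^ (p / N) + m)) := by
  have hp0 : 0 < p := by linarith
  have hN0 : (0 : ℝ) < N := by linarith
  have hq0 : 0 < q := by linarith
  have hps0 := sobolevExponent_pos hp hpN
  have hmem := hu.1.truncation hp hpN hk
  have henergy := hu.energy_le hp hpN hlam hK hk hpos hbd ha₁ hb₂ hA hB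
  have mw : AEMeasurable (fun x => max (-u x - k) 0) (volume.restrict Ω) := hmem.1.1.aemeasurable
  have hD0 : 0 ≤ energyConst p lam K := by unfold energyConst; positivity
  have hsob := hmem.eLpNorm_le hp hpN
  set E : Set (EuclideanSpace ℝ (Fin N)) := {x | u x < -k} with hEdef
  set w : EuclideanSpace ℝ (Fin N) → ℝ := fun x => max (-u x - k) 0 with hw
  set Dw := E.indicator fun x => -Du x with hDw
  set μ := volume.restrict Ω with hμ
  set s := sobolevExponent N p with hs
  set Sob := SNormLESNormFDerivOfEqConst ℝ (volume : Measure (EuclideanSpace ℝ (Fin N))) p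
  have hps : p / s = 1 - p / N := by
    rw [hs, sobolevExponent]
    have : (N : ℝ) - p ≠ 0 := by linarith
    field_simp
  have hpN1 : p / N < 1 := (div_lt_one hN0).2 hpN
  have hpq : p / q < p / N := div_lt_div_of_pos_left hp0 hN0 hq
  have hS' : S = (∫⁻ x, ‖w x‖ₑ ^ s ∂μ) ^ (1 - p / N) := by
    rw [hS, eLpNorm_eq_lintegral_rpow_enorm_toReal (by simpa using hps0) ENNReal.ofReal_ne_top,
      ENNReal.toReal_ofReal hps0.le, ← ENNReal.rpow_mul, ← hps]
    congr 1; ring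
  have hab' : (∫⁻ x, ‖a₁ x + b₂ x‖ₑ ^ (q / p) ∂μ) ^ (p / q) ≤ ENNReal.ofReal K := by
    rw [eLpNorm_eq_lintegral_rpow_enorm_toReal (by simpa using div_pos hq0 hp0)
      ENNReal.ofReal_ne_top, ENNReal.toReal_ofReal (div_pos hq0 hp0).le, one_div_div] at hab
    exact hab
  have hDw' : eLpNorm Dw (ENNReal.ofReal p) μ ^ p = ∫⁻ x, ‖Dw x‖ₑ ^ p ∂μ := by
    rw [eLpNorm_eq_lintegral_rpow_enorm_toReal (by simpa using hp0) ENNReal.ofReal_ne_top,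
      ENNReal.toReal_ofReal hp0.le, ← ENNReal.rpow_mul, one_div_mul_cancel hp0.ne',
      ENNReal.rpow_one]
  have mab : AEMeasurable (fun x => ‖a₁ x + b₂ x‖ₑ ^ (q / p)) μ :=
    (ha₁.add hb₂).enorm.pow_const _
  have mws : AEMeasurable (fun x => ‖w x‖ₑ ^ s) μ := mw.enorm.pow_const _
  have eab : ∀ x, (‖a₁ x + b₂ x‖ₑ ^ (q / p)) ^ (p / q) = ‖a₁ x + b₂ x‖ₑ := fun x => by
    rw [← ENNReal.rpow_mul, div_mul_div_cancel₀ hp0.ne', div_self hq0.ne', ENNReal.rpow_one]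
  have ew : ∀ x, (‖w x‖ₑ ^ s) ^ (1 - p / N) = ‖w x‖ₑ ^ p := fun x => by
    rw [← ENNReal.rpow_mul, ← hps, mul_div_cancel₀ _ hps0.ne']
  -- The Hölder weights are `p/q` for the coefficient, `p/p* = 1 - p/N` for `w`, and the remainder
  -- for the indicator of `E`; that remainder is positive because `q > N`. `H2` and `H3` drop one of
  -- the factors.
  have H1 : ∫⁻ x in E, ‖a₁ x + b₂ x‖ₑ * ‖w x‖ₑ ^ p ∂μ ≤
      ENNReal.ofReal K * (S * m ^ (p / N - p / q)) := by
    have := setLIntegral_rpow_mul_rpow_le mab mws E (a := p / q) (b := 1 - p / N)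
      (c := p / N - p / q) (by positivity) (by linarith) (by linarith) (by ring)
    simp only [eab, ew, ← hS', ← hm, mul_assoc] at this
    exact this.trans (by gcongr)
  have H2 : ∫⁻ x in E, ‖a₁ x + b₂ x‖ₑ ∂μ ≤ ENNReal.ofReal K * m ^ (1 - p / q) := by
    have := setLIntegral_rpow_mul_rpow_le mab mws E (a := p / q) (b := 0)
      (c := 1 - p / q) (by positivity) le_rfl (by linarith) (by ring)
    simp only [eab, ← hm, ENNReal.rpow_zero, mul_one] at this
    exact this.trans (by gcongr)
  have H3 : ∫⁻ x in E, ‖w x‖ₑ ^ p ∂μ ≤ S * m ^ (p / N) := by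
    have := setLIntegral_rpow_mul_rpow_le mab mws E (a := 0) (b := 1 - p / N)
      (c := p / N) le_rfl (by linarith) (by positivity) (by ring)
    simpa only [ew, ← hm, ← hS', ENNReal.rpow_zero, one_mul] using this
  have H : ∫⁻ x in E, (‖a₁ x + b₂ x‖ₑ * (‖w x‖ₑ ^ p + ENNReal.ofReal (k ^ p))
          + (‖w x‖ₑ ^ p + 1)) ∂μ ≤
      ENNReal.ofReal K * (S * m ^ (p / N - p / q) + ENNReal.ofReal (k ^ p) * m ^ (1 - p / q)) +
        (S * m ^ (p / N) + m) := by
    have mwp : AEMeasurable (fun x => ‖w x‖ₑ ^ p) (μ.restrict E) :=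
      (mw.enorm.pow_const _).restrict
    have mab' : AEMeasurable (fun x => ‖a₁ x + b₂ x‖ₑ) (μ.restrict E) :=
      (ha₁.add hb₂).enorm.restrict
    have mw1 : AEMeasurable (fun x => ‖w x‖ₑ ^ p + 1) (μ.restrict E) :=
      mwp.add aemeasurable_const
    simp only [mul_add]
    rw [lintegral_add_right' _ mw1,
      lintegral_add_right' _ aemeasurable_const, lintegral_add_right' _ (mab'.mul_const _),
      lintegral_mul_const' _ _ ENNReal.ofReal_ne_top, lintegral_one, Measure.restrict_apply_univ,
      ← hm]
    refine add_le_add (add_le_add H1 ?_) (add_le_add H3 le_rfl)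
    calc _ ≤ (ENNReal.ofReal K * m ^ (1 - p / q)) * ENNReal.ofReal (k ^ p) := by gcongr
      _ = _ := by ring
  have hl0 : ENNReal.ofReal (lam / 2) ≠ 0 := by simpa using hlam
  have henergy' : ∫⁻ x, ‖Dw x‖ₑ ^ p ∂μ ≤ ENNReal.ofReal (energyConst p lam K / (lam / 2)) *
      ∫⁻ x in E, (‖a₁ x + b₂ x‖ₑ * (‖w x‖ₑ ^ p + ENNReal.ofReal (k ^ p))
          + (‖w x‖ₑ ^ p + 1)) ∂μ := by
    rw [ENNReal.ofReal_div_of_pos (half_pos hlam), ENNReal.mul_div_right_comm.symm,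
      ENNReal.le_div_iff_mul_le (Or.inl hl0) (Or.inl ENNReal.ofReal_ne_top), mul_comm]
    exact henergy
  calc S = eLpNorm w (ENNReal.ofReal s) μ ^ p := hS
    _ ≤ (Sob * eLpNorm Dw (ENNReal.ofReal p) μ) ^ p := ENNReal.rpow_le_rpow hsob hp0.le
    _ = (Sob : ℝ≥0∞) ^ p * ∫⁻ x, ‖Dw x‖ₑ ^ p ∂μ := by
        rw [ENNReal.mul_rpow_of_nonneg _ _ hp0.le, hDw']
    _ ≤ _ := by
        rw [mul_assoc]
        gcongr
        exact henergy'.trans (by gcongr)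

end

/-! ### Decay of the measure of the superlevel sets -/

/-- Stampacchia's iteration along the levels `M (1 - 2⁻⁽ʲ⁺¹⁾)`. -/
theorem stampacchia_iteration {m : ℝ → ℝ} {p D M y ε ν : ℝ} (hm : ∀ k, 0 ≤ m k) (hD : 0 ≤ D)
    (hp : 0 < p) (hM : 0 < M) (hy : 0 < y) (hε : 0 < ε) (hεν : ε ≤ ν) (hν : ν < 1)
    (hrec : ∀ k h, M / 2 ≤ k → k < h →
      (h - k) ^ p * m h ^ (1 - ν) ≤ 2 * D * (k ^ p * m k ^ (1 - ν + ε) + m k))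
    (h0 : m (M / 2) ≤ y)
    (hsmall : 2 * D * 4 ^ p * (y ^ ε + y ^ ν / M ^ p) ≤ ((2 : ℝ) ^ (-p / ε)) ^ (1 - ν)) (j : ℕ) :
    m (M * (1 - (1 / 2) ^ (j + 1))) ≤ y * ((2 : ℝ) ^ (-p / ε)) ^ j := by
  set ρ : ℝ := (2 : ℝ) ^ (-p / ε) with hρ
  have hρ0 : 0 < ρ := by positivity
  have hρ1 : ρ ≤ 1 := Real.rpow_le_one_of_one_le_of_nonpos (by norm_num)
    (div_nonpos_of_nonpos_of_nonneg (by linarith) hε.le)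
  induction j with
  | zero =>
    convert h0 using 2 <;> norm_num
    ring
  | succ j ih =>
    set k := M * (1 - (1 / 2) ^ (j + 1)) with hk
    set h := M * (1 - (1 / 2) ^ (j + 1 + 1)) with hh
    have hj0 : (0 : ℝ) < (1 / 2) ^ (j + 1) := by positivity
    have hj1 : ((1 : ℝ) / 2) ^ (j + 1) ≤ 1 / 2 := by
      rw [pow_succ]
      have : ((1 : ℝ) / 2) ^ j ≤ 1 := pow_le_one₀ (by norm_num) (by norm_num)
      linarith
    have hkM : k ≤ M := by rw [hk]; nlinarith
    have hMk : M / 2 ≤ k := by rw [hk]; nlinarith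
    have hdiff : h - k = M * (1 / 2) ^ (j + 2) := by rw [hk, hh]; ring
    have hkh : k < h := by
      have : 0 < h - k := by rw [hdiff]; positivity
      linarith
    set R : ℝ := ρ ^ j with hR
    have hR0 : 0 < R := by positivity
    have hR1 : R ≤ 1 := pow_le_one₀ hρ0.le hρ1
    -- The ratio `ρ = 2^(-p/ε)` is chosen for this: the gain `R^ε` exactly compensates the loss `(h
    -- - k)^p` from the shrinking level gaps.
    have hRε : ((1 / 2 : ℝ) ^ (j + 2)) ^ p = R ^ ε / 4 ^ p := by
      have e1 : R ^ ε = (2 : ℝ) ^ (-p * j) := by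
        rw [hR, hρ, ← Real.rpow_natCast, ← Real.rpow_mul (by positivity),
          ← Real.rpow_mul (by norm_num)]
        congr 1
        field_simp
      have e2 : (4 : ℝ) ^ p = 2 ^ (2 * p) := by
        rw [Real.rpow_mul (by norm_num)]; norm_num
      have e3 : (1 / 2 : ℝ) = 2 ^ (-1 : ℝ) := by rw [Real.rpow_neg_one]; norm_num
      rw [e1, e2, e3, ← Real.rpow_natCast, ← Real.rpow_mul (by norm_num),
        ← Real.rpow_mul (by norm_num), ← Real.rpow_sub (by norm_num)]
      congr 1
      push_cast
      ring
    have hmain := hrec k h hMk hkh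
    rw [hdiff, Real.mul_rpow hM.le (by positivity), hRε] at hmain
    -- In the linear term, `R ≤ R^(1 - ν + ε)` since `R ≤ 1` and `ε ≤ ν`, so both terms decay at a
    -- common rate.
    have hup : k ^ p * m k ^ (1 - ν + ε) + m k ≤
        M ^ p * R ^ ε * (R ^ (1 - ν) * y ^ (1 - ν) * (y ^ ε + y ^ ν / M ^ p)) := by
      have hk0 : 0 ≤ k := le_trans (by positivity) hMk
      have he : 0 ≤ 1 - ν + ε := by linarith
      have f1 : k ^ p * m k ^ (1 - ν + ε) ≤ M ^ p * (y * R) ^ (1 - ν + ε) := by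
        have := hm k
        gcongr
      have f2 : m k ≤ y * R ^ (1 - ν + ε) := by
        refine ih.trans (mul_le_mul_of_nonneg_left ?_ hy.le)
        calc R = R ^ (1 : ℝ) := (Real.rpow_one R).symm
          _ ≤ R ^ (1 - ν + ε) := Real.rpow_le_rpow_of_exponent_ge hR0 hR1 (by linarith)
      have f3 : y ^ (1 - ν) * y ^ ν = y := by
        rw [← Real.rpow_add hy]; simp
      have hMp : M ^ p ≠ 0 := by positivity
      rw [Real.mul_rpow hy.le hR0.le, Real.rpow_add hy, Real.rpow_add hR0] at f1
      rw [Real.rpow_add hR0] at f2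
      refine (add_le_add f1 f2).trans (le_of_eq ?_)
      field_simp
      linear_combination (-1 : ℝ) * f3
    have hX : m h ^ (1 - ν) ≤ (y * ρ ^ (j + 1)) ^ (1 - ν) := by
      have hpos : 0 < M ^ p * (R ^ ε / 4 ^ p) := by positivity
      refine le_of_mul_le_mul_left (hmain.trans ?_) hpos
      calc 2 * D * (k ^ p * m k ^ (1 - ν + ε) + m k)
          ≤ 2 * D * (M ^ p * R ^ ε * (R ^ (1 - ν) * y ^ (1 - ν) * (y ^ ε + y ^ ν / M ^ p))) := by
            gcongr
        _ = M ^ p * (R ^ ε / 4 ^ p) * (R ^ (1 - ν) * y ^ (1 - ν) *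
              (2 * D * 4 ^ p * (y ^ ε + y ^ ν / M ^ p))) := by
            field_simp
        _ ≤ M ^ p * (R ^ ε / 4 ^ p) * (R ^ (1 - ν) * y ^ (1 - ν) * ρ ^ (1 - ν)) := by gcongr
        _ = _ := by
            rw [Real.mul_rpow hy.le (by positivity), pow_succ, Real.mul_rpow hR0.le hρ0.le]
            ring
    exact (Real.rpow_le_rpow_iff (hm h) (by positivity) (by linarith)).1 hX

/-- Chebyshev's inequality between two levels. -/
theorem rpow_mul_measure_le_eLpNorm_truncation {α : Type*} [MeasurableSpace α] {μ : Measure α}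
    {u : α → ℝ} (hu : AEMeasurable u μ) {s k h : ℝ} (hs : 0 < s) (hkh : k < h) :
    ENNReal.ofReal ((h - k) ^ s) * μ {x | u x < -h} ≤
      eLpNorm (fun x => max (-u x - k) 0) (ENNReal.ofReal s) μ ^ s := by
  have := mul_meas_ge_le_pow_eLpNorm' μ (p := ENNReal.ofReal s) (by simpa using hs)
    ENNReal.ofReal_ne_top (f := fun x => max (-u x - k) 0)
    ((hu.neg.sub_const k).max aemeasurable_const).aestronglyMeasurable (ENNReal.ofReal (h - k))
  rw [ENNReal.toReal_ofReal hs.le, ENNReal.ofReal_rpow_of_nonneg (by linarith) hs.le] at this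
  refine le_trans ?_ this
  refine mul_le_mul' le_rfl (measure_mono fun x (hx : u x < -h) => ?_)
  have : h - k ≤ max (-u x - k) 0 := le_max_of_le_left (by linarith)
  show ENNReal.ofReal (h - k) ≤ ‖max (-u x - k) 0‖ₑ
  rw [Real.enorm_of_nonneg (le_max_right _ _)]
  exact ENNReal.ofReal_le_ofReal this

section
variable {N : ℕ} {p : ℝ} {Ω : Set (EuclideanSpace ℝ (Fin N))}
  {A : EuclideanSpace ℝ (Fin N) → ℝ → EuclideanSpace ℝ (Fin N) → EuclideanSpace ℝ (Fin N)}
  {B : EuclideanSpace ℝ (Fin N) → ℝ → EuclideanSpace ℝ (Fin N) → ℝ}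
  {a₁ a₂ b₁ b₂ b₃ u : EuclideanSpace ℝ (Fin N) → ℝ}
  {Du : EuclideanSpace ℝ (Fin N) → EuclideanSpace ℝ (Fin N)}

/-- The constant in the recursive inequality for the measures of the superlevel sets. -/
noncomputable def recursionConst (N : ℕ) (p lam K : ℝ) : ℝ :=
  (SNormLESNormFDerivOfEqConst ℝ (volume : Measure (EuclideanSpace ℝ (Fin N))) p : ℝ) ^ p *
    (energyConst p lam K / (lam / 2)) * (K + 1)

/-- The recursive inequality for the measures of the superlevel sets `{-u > k}`, at levels where
they are small. -/
theorem IsWeakSupersolution.measure_recursion {lam K q k h D : ℝ} (hp : 1 < p) (hpN : p < N)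
    (hq : (N : ℝ) < q) (hlam : 0 < lam) (hK : 0 ≤ K) (hk : 0 ≤ k)
    (hpos : ∀ᵐ x ∂(volume.restrict Ω), 0 ≤ a₁ x ∧ 0 ≤ b₁ x ∧ 0 ≤ b₂ x)
    (hbd : ∀ᵐ x ∂(volume.restrict Ω), a₂ x ≤ K ∧ b₁ x ≤ K ∧ b₃ x ≤ K)
    (ha₁ : AEMeasurable a₁ (volume.restrict Ω)) (hb₂ : AEMeasurable b₂ (volume.restrict Ω))
    (hab : eLpNorm (fun x => a₁ x + b₂ x) (ENNReal.ofReal (q / p)) (volume.restrict Ω) ≤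
      ENNReal.ofReal K)
    (hA : StructureCondA p lam Ω A a₁ a₂) (hB : StructureCondB p Ω B b₁ b₂ b₃)
    (hu : IsWeakSupersolution p Ω A B u Du) (hD : recursionConst N p lam K ≤ D)
    (hkh : k < h) (hfin : volume.restrict Ω {x | u x < -k} ≠ ⊤)
    (hm1 : (volume.restrict Ω).real {x | u x < -k} ≤ 1)
    (hmD : 4 * D * (volume.restrict Ω).real {x | u x < -k} ^ (p / N - p / q) ≤ 1) :
    (h - k) ^ p * (volume.restrict Ω).real {x | u x < -h} ^ (1 - p / N) ≤
      2 * D * (k ^ p * (volume.restrict Ω).real {x | u x < -k} ^ (1 - p / N + (p / N - p / q)) +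
        (volume.restrict Ω).real {x | u x < -k}) := by
  have hp0 : 0 < p := by linarith
  have hN0 : (0 : ℝ) < N := by linarith
  have hq0 : 0 < q := by linarith
  have hps0 := sobolevExponent_pos hp hpN
  have hpN1 : p / N < 1 := (div_lt_one hN0).2 hpN
  have hpq : p / q < p / N := div_lt_div_of_pos_left hp0 hN0 hq
  have hps : p / sobolevExponent N p = 1 - p / N := by
    rw [sobolevExponent]
    have : (N : ℝ) - p ≠ 0 := by linarith
    field_simp
  have hE0 : 0 ≤ energyConst p lam K / (lam / 2) := by unfold energyConst; positivity
  set μ := volume.restrict Ω with hμ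
  have hfinh : μ {x | u x < -h} ≠ ⊤ := by
    refine ne_top_of_le_ne_top hfin (measure_mono fun x (hx : u x < -h) => ?_)
    show u x < -k
    linarith
  have mu : AEMeasurable u μ := hu.1.1.1.aemeasurable
  have hmem := hu.1.truncation hp hpN hk
  set n := eLpNorm (fun x => max (-u x - k) 0) (ENNReal.ofReal (sobolevExponent N p)) μ with hn
  have hnfin : n ≠ ⊤ := hmem.1.2.ne
  set s := n.toReal ^ p with hs
  have hs0 : 0 ≤ s := by positivity
  have hsn : n ^ p = ENNReal.ofReal s := by
    rw [hs, ← ENNReal.ofReal_rpow_of_nonneg ENNReal.toReal_nonneg hp0.le,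
      ENNReal.ofReal_toReal hnfin]
  -- Chebyshev in `L^{p*}`, raised to the power `p/p* = 1 - p/N`.
  have cheb : (h - k) ^ p * μ.real {x | u x < -h} ^ (1 - p / N) ≤ s := by
    have h1 := rpow_mul_measure_le_eLpNorm_truncation mu hps0 hkh
    have h2 := ENNReal.rpow_le_rpow h1 (z := p / sobolevExponent N p) (by positivity)
    rw [← ENNReal.rpow_mul, mul_div_cancel₀ _ hps0.ne', ← hn, hsn,
      ENNReal.mul_rpow_of_nonneg _ _ (by positivity), ← ofReal_measureReal hfinh,
      ENNReal.ofReal_rpow_of_nonneg (by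
        have : 0 < h - k := by linarith
        positivity) (by positivity),
      ENNReal.ofReal_rpow_of_nonneg measureReal_nonneg (by positivity),
      ← ENNReal.ofReal_mul (by
        have : 0 < h - k := by linarith
        positivity), ENNReal.ofReal_le_ofReal_iff hs0, ← Real.rpow_mul (by linarith),
      mul_div_cancel₀ _ hps0.ne', hps] at h2
    exact h2
  set m := μ.real {x | u x < -k} with hm
  have hm0 : 0 ≤ m := measureReal_nonneg
  have level := hu.eLpNorm_truncation_le hp hpN hq hlam hK hk hpos hbd ha₁ hb₂ hab hA hB
    (S := ENNReal.ofReal s) (m := ENNReal.ofReal m) hsn.symm (ofReal_measureReal hfin)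
  have hkp : 0 ≤ k ^ p := Real.rpow_nonneg hk p
  have e0 : 0 ≤ p / N - p / q := by linarith
  have e1 : 0 ≤ 1 - p / q := by linarith
  have e2 : 0 ≤ p / N := by positivity
  have g0 := Real.rpow_nonneg hm0 (p / N - p / q)
  have g1 := Real.rpow_nonneg hm0 (1 - p / q)
  have g2 := Real.rpow_nonneg hm0 (p / N)
  rw [← ENNReal.ofReal_coe_nnreal, ENNReal.ofReal_rpow_of_nonneg (NNReal.coe_nonneg _) hp0.le,
    ENNReal.ofReal_rpow_of_nonneg hm0 e0, ENNReal.ofReal_rpow_of_nonneg hm0 e1,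
    ENNReal.ofReal_rpow_of_nonneg hm0 e2, ← ENNReal.ofReal_mul (by positivity),
    ← ENNReal.ofReal_mul hs0, ← ENNReal.ofReal_mul hkp, ← ENNReal.ofReal_mul hs0,
    ← ENNReal.ofReal_add (by positivity) (by positivity), ← ENNReal.ofReal_mul hK,
    ← ENNReal.ofReal_add (by positivity) (by positivity),
    ← ENNReal.ofReal_add (by positivity) (by positivity), ← ENNReal.ofReal_mul (by positivity),
    ENNReal.ofReal_le_ofReal_iff (by positivity)] at level
  set c := (SNormLESNormFDerivOfEqConst ℝ (volume : Measure (EuclideanSpace ℝ (Fin N))) p : ℝ) ^ p *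
    (energyConst p lam K / (lam / 2)) with hc
  have hc0 : 0 ≤ c := by positivity
  have hcD : c * (K + 1) ≤ D := hD
  have hD0 : 0 ≤ D := le_trans (by positivity) hcD
  -- As `m ≤ 1`, both terms containing `s` can be given the smaller exponent and absorbed together.
  have g3 : m ^ (p / N) ≤ m ^ (p / N - p / q) :=
    Real.rpow_le_rpow_of_exponent_ge' hm0 hm1 e0 (by have : 0 ≤ p / q := by positivity
                                                     linarith)
  rw [show 1 - p / (N : ℝ) + (p / N - p / q) = 1 - p / q by ring]
  have hlev2 : s ≤ D * (2 * (s * m ^ (p / N - p / q)) + (k ^ p * m ^ (1 - p / q) + m)) := by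
    refine level.trans ?_
    have i1 : 0 ≤ s * m ^ (p / N - p / q) := by positivity
    have i2 : 0 ≤ k ^ p * m ^ (1 - p / q) := by positivity
    calc c * (K * (s * m ^ (p / N - p / q) + k ^ p * m ^ (1 - p / q)) + (s * m ^ (p / N) + m))
        ≤ c * (K * (s * m ^ (p / N - p / q) + k ^ p * m ^ (1 - p / q)) +
            (s * m ^ (p / N - p / q) + m)) := by gcongr
      _ ≤ c * ((K + 1) * (2 * (s * m ^ (p / N - p / q)) + (k ^ p * m ^ (1 - p / q) + m))) := by
          gcongr
          have j1 := mul_nonneg hK i1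
          have j3 := mul_nonneg hK hm0
          nlinarith
      _ = c * (K + 1) * (2 * (s * m ^ (p / N - p / q)) + (k ^ p * m ^ (1 - p / q) + m)) := by ring
      _ ≤ _ := by gcongr
  -- Absorption into the left side, legitimate because `s` is a finite real; it doubles the constant
  -- to `2 * D`.
  have : D * (2 * (s * m ^ (p / N - p / q))) ≤ s / 2 := by
    have := mul_le_mul_of_nonneg_left hmD hs0
    linarith
  linarith

/-- The passage from the recursive inequality to the bound of `u⁻`. -/
theorem exists_eLpNorm_top_negPart_le {p β ε D : ℝ} (hp : 0 < p) (hpN : p < N) (hβ : 0 < β)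
    (hε : 0 < ε) (hεN : ε ≤ p / N) (hD : 0 < D) :
    ∃ C : ℝ≥0, ∀ {α : Type} [MeasurableSpace α] (μ : Measure α) (u : α → ℝ),
      MemLp u (ENNReal.ofReal β) μ →
      (∀ k h : ℝ, 0 ≤ k → k < h → μ {x | u x < -k} ≠ ⊤ → μ.real {x | u x < -k} ≤ 1 →
        4 * D * μ.real {x | u x < -k} ^ ε ≤ 1 →
        (h - k) ^ p * μ.real {x | u x < -h} ^ (1 - p / N) ≤
          2 * D * (k ^ p * μ.real {x | u x < -k} ^ (1 - p / N + ε) + μ.real {x | u x < -k})) →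
      eLpNorm (fun x => max (-u x) 0) ⊤ μ ≤ C *
        max (eLpNorm (fun x => max (-u x) 0) (ENNReal.ofReal β) μ ^ (β / (N + β)))
          (eLpNorm (fun x => max (-u x) 0) (ENNReal.ofReal β) μ) := by
  have hN0 : (0 : ℝ) < N := by linarith
  have hpN1 : p / N < 1 := (div_lt_one hN0).2 hpN
  set ρ : ℝ := (2 : ℝ) ^ (-p / ε) with hρ
  have hρ0 : 0 < ρ := by positivity
  have hρ1 : ρ < 1 := Real.rpow_lt_one_of_one_lt_of_neg (by norm_num)
    (div_neg_of_neg_of_pos (by linarith) hε)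
  -- The three entries give, in turn, `y ≤ 1`, the absorption condition, and the smallness required
  -- to start the iteration.
  set η : ℝ := min 1 (min (1 / (4 * D)) (ρ ^ (1 - p / N) / (4 * D * 4 ^ p))) with hη
  have hη0 : 0 < η := by positivity
  have hη1 : η ≤ 1 := min_le_left _ _
  have hη2 : 4 * D * η ≤ 1 := by
    have : η ≤ 1 / (4 * D) := (min_le_right _ _).trans (min_le_left _ _)
    rwa [le_div_iff₀ (by positivity), mul_comm] at this
  have hη3 : 4 * D * 4 ^ p * η ≤ ρ ^ (1 - p / N) := by
    have : η ≤ ρ ^ (1 - p / N) / (4 * D * 4 ^ p) := (min_le_right _ _).trans (min_le_right _ _)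
    rwa [le_div_iff₀ (by positivity), mul_comm] at this
  set y : ℝ := η ^ (1 / ε) with hy
  have hy0 : 0 < y := by positivity
  have hy1 : y ≤ 1 := Real.rpow_le_one hη0.le hη1 (by positivity)
  have hyε : y ^ ε = η := by
    rw [hy, ← Real.rpow_mul hη0.le, one_div_mul_cancel hε.ne', Real.rpow_one]
  -- Chosen so that `(2/c)^β = y`: then `M ≥ c t` forces `(2t/M)^β ≤ y`.
  set c : ℝ := 2 * y ^ (-1 / β) with hc
  have hyβ : 1 ≤ y ^ (-1 / β) := Real.one_le_rpow_of_pos_of_le_one_of_nonpos hy0 hy1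
    (div_nonpos_of_nonpos_of_nonneg (by norm_num) hβ.le)
  have hc1 : 1 ≤ c := by linarith
  have hc0 : 0 < c := by linarith
  have hcy : y * c ^ β = 2 ^ β := by
    rw [hc, Real.mul_rpow (by norm_num) (by positivity), ← Real.rpow_mul hy0.le,
      div_mul_cancel₀ _ hβ.ne', Real.rpow_neg_one]
    field_simp
  refine ⟨c.toNNReal, fun {α} _ μ u hu hrec => ?_⟩
  have mu : AEMeasurable u μ := hu.1.aemeasurable
  have mv : AEMeasurable (fun x => max (-u x) 0) μ := mu.neg.max aemeasurable_const
  have hv : MemLp (fun x => max (-u x) 0) (ENNReal.ofReal β) μ := by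
    refine hu.of_le mv.aestronglyMeasurable (Eventually.of_forall fun x => ?_)
    rw [Real.norm_of_nonneg (le_max_right _ _)]
    exact max_le (neg_le_abs _) (abs_nonneg _)
  have hβ0 : ENNReal.ofReal β ≠ 0 := by simpa using hβ
  set T := eLpNorm (fun x => max (-u x) 0) (ENNReal.ofReal β) μ with hT
  -- The case `u⁻ = 0` is separate because the level `M` below must be positive.
  rcases eq_or_ne T 0 with hT0 | hT0
  · have h0 := (eLpNorm_eq_zero_iff mv.aestronglyMeasurable hβ0).1 hT0
    rw [eLpNorm_congr_ae h0, eLpNorm_zero]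
    exact zero_le
  have hTtop : T ≠ ⊤ := hv.2.ne
  set t := T.toReal with ht
  have ht0 : 0 < t := ENNReal.toReal_pos hT0 hTtop
  have hTt : T = ENNReal.ofReal t := (ENNReal.ofReal_toReal hTtop).symm
  set θ := β / (N + β) with hθ
  have hθ0 : 0 < θ := by positivity
  set M := c * max (t ^ θ) t with hM
  have hM0 : 0 < M := by positivity
  have hMt : c * t ≤ M := by
    rw [hM]; gcongr; exact le_max_right _ _
  have hMθ : c * t ^ θ ≤ M := by
    rw [hM]; gcongr; exact le_max_left _ _
  have hgoal : (c.toNNReal : ℝ≥0∞) * max (T ^ θ) T = ENNReal.ofReal M := by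
    rw [hM, hTt, ENNReal.ofReal_rpow_of_nonneg ht0.le hθ0.le,
      ← ENNReal.ofReal_max, ENNReal.ofReal_mul hc0.le]
    rfl
  rw [hgoal]
  have cheb : ∀ h : ℝ, 0 < h → ENNReal.ofReal (h ^ β) * μ {x | u x < -h} ≤
      ENNReal.ofReal (t ^ β) := by
    intro h hh
    have := rpow_mul_measure_le_eLpNorm_truncation mu hβ hh
    simp only [sub_zero] at this
    rwa [← hT, hTt, ENNReal.ofReal_rpow_of_nonneg ht0.le hβ.le] at this
  have hfin : ∀ h : ℝ, 0 < h → μ {x | u x < -h} ≠ ⊤ := by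
    intro h hh htop
    have := cheb h hh
    rw [htop, ENNReal.mul_top (by simpa using Real.rpow_pos_of_pos hh β)] at this
    exact absurd this (by simp)
  have hmono : ∀ k h : ℝ, 0 < k → k ≤ h →
      μ.real {x | u x < -h} ≤ μ.real {x | u x < -k} := fun k h hk hkh =>
    measureReal_mono (fun x (hx : u x < -h) => (show u x < -k by linarith)) (hfin k hk)
  set y₀ := (2 * t / M) ^ β with hy₀
  have hy₀0 : 0 < y₀ := by positivity
  have h0 : μ.real {x | u x < -(M / 2)} ≤ y₀ := by
    have hM2 : 0 < M / 2 := by positivity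
    have := cheb (M / 2) hM2
    rw [← ofReal_measureReal (hfin _ hM2), ← ENNReal.ofReal_mul (by positivity),
      ENNReal.ofReal_le_ofReal_iff (by positivity)] at this
    have e : y₀ = t ^ β / (M / 2) ^ β := by
      rw [hy₀, ← Real.div_rpow ht0.le hM2.le]
      congr 1
      field_simp
    rw [e, le_div_iff₀ (by positivity), mul_comm]
    exact this
  have hy₀y : y₀ ≤ y := by
    have e : y = (2 / c) ^ β := by
      rw [Real.div_rpow (by norm_num) hc0.le, ← hcy]
      field_simp
    have hle : 2 * t / M ≤ 2 / c := by
      rw [div_le_div_iff₀ hM0 hc0]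
      linarith
    rw [e, hy₀]
    exact Real.rpow_le_rpow (by positivity) hle hβ.le
  -- This fixes the exponent: `θ (N + β) = β`, so `M ≥ c t^θ` controls `t^β` by `M^(N + β)`. It
  -- makes `y₀^(p/N) / M^p` small, as the inhomogeneous term requires.
  have hMy₀ : y₀ ≤ y * M ^ (N : ℝ) := by
    rw [hy₀, Real.div_rpow (by positivity) hM0.le, div_le_iff₀ (by positivity), mul_assoc,
      ← Real.rpow_add hM0, Real.mul_rpow (by norm_num) ht0.le, ← hcy]
    have e : t ^ β = (t ^ θ) ^ ((N : ℝ) + β) := by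
      rw [← Real.rpow_mul ht0.le, hθ, div_mul_cancel₀ _ (by positivity)]
    calc y * c ^ β * t ^ β ≤ y * c ^ ((N : ℝ) + β) * t ^ β := by
          gcongr
          linarith
      _ = y * (c * t ^ θ) ^ ((N : ℝ) + β) := by
          rw [e, Real.mul_rpow hc0.le (by positivity), mul_assoc]
      _ ≤ y * M ^ ((N : ℝ) + β) := by gcongr
  have hyν : y ^ (p / N) ≤ η := by
    rw [← hyε]
    exact Real.rpow_le_rpow_of_exponent_ge hy0 hy1 hεN
  have hsmall : 2 * D * 4 ^ p * (y₀ ^ ε + y₀ ^ (p / N) / M ^ p) ≤ ρ ^ (1 - p / N) := by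
    have i1 : y₀ ^ ε ≤ η := by
      rw [← hyε]; gcongr
    have i2 : y₀ ^ (p / N) / M ^ p ≤ η := by
      refine le_trans ?_ hyν
      rw [div_le_iff₀ (by positivity)]
      calc y₀ ^ (p / N) ≤ (y * M ^ (N : ℝ)) ^ (p / N) := by gcongr
        _ = y ^ (p / N) * M ^ p := by
          rw [Real.mul_rpow hy0.le (by positivity), ← Real.rpow_mul hM0.le,
            mul_div_cancel₀ _ hN0.ne']
    calc 2 * D * 4 ^ p * (y₀ ^ ε + y₀ ^ (p / N) / M ^ p) ≤ 2 * D * 4 ^ p * (η + η) := by gcongr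
      _ = 4 * D * 4 ^ p * η := by ring
      _ ≤ _ := hη3
  have iter := stampacchia_iteration (m := fun k => μ.real {x | u x < -k})
    (fun _ => measureReal_nonneg) hD.le hp hM0 hy₀0 hε hεN hpN1 (fun k h hk hkh => by
      have hk0 : 0 < k := lt_of_lt_of_le (by positivity) hk
      have hmk : μ.real {x | u x < -k} ≤ y := (hmono _ _ (by positivity) hk).trans (h0.trans hy₀y)
      refine hrec k h hk0.le hkh (hfin k hk0) (hmk.trans hy1) (le_trans ?_ hη2)
      rw [← hyε]
      gcongr) h0 hsmall
  -- All levels of the iteration lie below `M`, so the measure at level `M` is at most `y₀ ρ^j` for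
  -- every `j`.
  have hzero : μ {x | u x < -M} = 0 := by
    have hle : ∀ j : ℕ, μ.real {x | u x < -M} ≤ y₀ * ρ ^ j := by
      intro j
      have h1 : ((1 : ℝ) / 2) ^ (j + 1) < 1 := pow_lt_one₀ (by norm_num) (by norm_num) (by simp)
      have h2 : (0 : ℝ) < (1 / 2) ^ (j + 1) := by positivity
      refine (hmono _ _ ?_ ?_).trans (iter j)
      · exact mul_pos hM0 (by linarith)
      · nlinarith
    have hlim : Tendsto (fun j : ℕ => y₀ * ρ ^ j) atTop (𝓝 0) := by
      simpa using (tendsto_pow_atTop_nhds_zero_of_lt_one hρ0.le hρ1).const_mul y₀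
    have := ge_of_tendsto' hlim hle
    exact (measureReal_eq_zero_iff (hfin M hM0)).1 (le_antisymm this measureReal_nonneg)
  rw [eLpNorm_exponent_top]
  refine eLpNormEssSup_le_of_ae_bound ?_
  filter_upwards [measure_eq_zero_iff_ae_notMem.1 hzero] with x hx
  rw [Real.norm_of_nonneg (le_max_right _ _)]
  have hx' : ¬ u x < -M := hx
  exact max_le (by linarith) hM0.le

end

/-! ### Monotone dependence of the constant on the data, and the theorem -/

/-- A function that is bounded on bounded sets of parameters can be replaced by a nondecreasing
one. -/
theorem exists_monotone_of_forall_bound {ι : Type*} [Fintype ι] {P : (ι → ℝ≥0) → ℝ≥0 → Prop}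
    (hP : ∀ d c c', c ≤ c' → P d c → P d c')
    (h : ∀ n : ℕ, ∃ c, ∀ d, (∀ i, d i ≤ (n : ℝ≥0)) → P d c) :
    ∃ C : (ι → ℝ≥0) → ℝ≥0, Monotone C ∧ ∀ d, P d (C d) := by
  choose c hc using h
  -- Summing the nonnegative `c n` forces monotonicity; the `+ 1` keeps the index `⌈∑ i, d i⌉₊`,
  -- which bounds each `d i`, in the range.
  refine ⟨fun d => ∑ n ∈ Finset.range (⌈∑ i, d i⌉₊ + 1), c n, fun d d' hdd => ?_, fun d => ?_⟩
  · refine Finset.sum_le_sum_of_subset (Finset.range_mono ?_)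
    exact Nat.add_le_add_right (Nat.ceil_mono (Finset.sum_le_sum fun i _ => hdd i)) 1
  · refine hP d (c ⌈∑ i, d i⌉₊) _ ?_ (hc _ d fun i => ?_)
    · exact Finset.single_le_sum (f := c) (fun _ _ => zero_le) (Finset.self_mem_range_succ _)
    · exact (Finset.single_le_sum (f := d) (fun _ _ => zero_le) (Finset.mem_univ i)).trans
        (Nat.le_ceil _)

/-- Membership in `L^∞` is essential, since `lebNorm` takes the value `0` when the norm is infinite.
-/
theorem ae_le_of_lebNorm_top_le {N : ℕ} {f : EuclideanSpace ℝ (Fin N) → ℝ}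
    {Ω : Set (EuclideanSpace ℝ (Fin N))} (hf : MemLp f ∞ (volume.restrict Ω)) {K : ℝ≥0}
    (h : lebNorm f ∞ Ω ≤ K) : ∀ᵐ x ∂(volume.restrict Ω), f x ≤ K := by
  have hle : eLpNormEssSup f (volume.restrict Ω) ≤ K := by
    rw [← eLpNorm_exponent_top, ← ENNReal.coe_toNNReal hf.2.ne]
    exact_mod_cast h
  filter_upwards [ae_le_eLpNormEssSup (f := f) (μ := volume.restrict Ω)] with x hx
  have h1 : ‖f x‖ₑ ≤ (K : ℝ≥0∞) := hx.trans hle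
  have h2 : ‖f x‖₊ ≤ K := by exact_mod_cast h1
  exact (le_abs_self _).trans (by exact_mod_cast h2)

theorem corollary2p3 (N : ℕ) (p β : ℝ) (hp : 1 < p) (hpN : p < N) (hβ : p < β) :
    ∃ θ₀ : ℝ, 0 < θ₀ ∧ θ₀ ≤ 1 ∧
      ∀ q lam : ℝ, (N : ℝ) < q → 0 < lam →
        ∃ C : (Fin 5 → ℝ≥0) → ℝ≥0, Monotone C ∧
          ∀ (Ω : Set (EuclideanSpace ℝ (Fin N)))
            (A : EuclideanSpace ℝ (Fin N) → ℝ → EuclideanSpace ℝ (Fin N) →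
              EuclideanSpace ℝ (Fin N))
            (B : EuclideanSpace ℝ (Fin N) → ℝ → EuclideanSpace ℝ (Fin N) → ℝ)
            (a₁ a₂ b₁ b₂ b₃ : EuclideanSpace ℝ (Fin N) → ℝ)
            (u : EuclideanSpace ℝ (Fin N) → ℝ)
            (Du : EuclideanSpace ℝ (Fin N) → EuclideanSpace ℝ (Fin N)),
            IsOpen Ω →
            IsCaratheodory Ω A → IsCaratheodory Ω B →
            (∀ᵐ x ∂(volume.restrict Ω),
              0 ≤ a₁ x ∧ 0 ≤ a₂ x ∧ 0 ≤ b₁ x ∧ 0 ≤ b₂ x ∧ 0 ≤ b₃ x) →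
            StructureCondA p lam Ω A a₁ a₂ →
            StructureCondB p Ω B b₁ b₂ b₃ →
            MemLp b₁ ∞ (volume.restrict Ω) →
            MemLp a₁ (ENNReal.ofReal (q / p)) (volume.restrict Ω) →
            MemLp b₂ (ENNReal.ofReal (q / p)) (volume.restrict Ω) →
            MemLp a₂ (ENNReal.ofReal (β / p)) (volume.restrict Ω) →
            MemLp a₂ ∞ (volume.restrict Ω) →
            MemLp b₃ (ENNReal.ofReal (β / (p - 1))) (volume.restrict Ω) →
            MemLp b₃ ∞ (volume.restrict Ω) →
            MemLp u (ENNReal.ofReal β) (volume.restrict Ω) →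
            IsWeakSupersolution p Ω A B u Du →
            eLpNorm (fun x => max (-u x) 0) ∞ (volume.restrict Ω) ≤
              (C ![lebNorm b₁ ∞ Ω,
                  lebNorm a₁ (ENNReal.ofReal (q / p)) Ω,
                  lebNorm b₂ (ENNReal.ofReal (q / p)) Ω,
                  lebNorm a₂ (ENNReal.ofReal (β / p)) Ω + lebNorm a₂ ∞ Ω,
                  lebNorm b₃ (ENNReal.ofReal (β / (p - 1))) Ω + lebNorm b₃ ∞ Ω] : ℝ≥0∞) *
                max (eLpNorm (fun x => max (-u x) 0) (ENNReal.ofReal β)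
                      (volume.restrict Ω) ^ θ₀)
                  (eLpNorm (fun x => max (-u x) 0) (ENNReal.ofReal β)
                      (volume.restrict Ω)) := by
  have hp0 : 0 < p := by linarith
  have hβ0 : 0 < β := by linarith
  have hN0 : (0 : ℝ) < N := by linarith
  refine ⟨β / (N + β), by positivity, (div_le_one (by positivity)).2 (by linarith), ?_⟩
  intro q lam hq hlam
  have hq0 : 0 < q := by linarith
  have hpq : p / q < p / N := div_lt_div_of_pos_left hp0 hN0 hq
  have hpq0 : 0 < p / q := by positivity
  obtain ⟨C, hC, hCP⟩ := exists_monotone_of_forall_bound (ι := Fin 5)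
    (P := fun d c => ∀ (Ω : Set (EuclideanSpace ℝ (Fin N)))
            (A : EuclideanSpace ℝ (Fin N) → ℝ → EuclideanSpace ℝ (Fin N) →
              EuclideanSpace ℝ (Fin N))
            (B : EuclideanSpace ℝ (Fin N) → ℝ → EuclideanSpace ℝ (Fin N) → ℝ)
            (a₁ a₂ b₁ b₂ b₃ : EuclideanSpace ℝ (Fin N) → ℝ)
            (u : EuclideanSpace ℝ (Fin N) → ℝ)
            (Du : EuclideanSpace ℝ (Fin N) → EuclideanSpace ℝ (Fin N)),
            (∀ᵐ x ∂(volume.restrict Ω), 0 ≤ a₁ x ∧ 0 ≤ b₁ x ∧ 0 ≤ b₂ x) →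
            StructureCondA p lam Ω A a₁ a₂ →
            StructureCondB p Ω B b₁ b₂ b₃ →
            MemLp b₁ ∞ (volume.restrict Ω) →
            MemLp a₁ (ENNReal.ofReal (q / p)) (volume.restrict Ω) →
            MemLp b₂ (ENNReal.ofReal (q / p)) (volume.restrict Ω) →
            MemLp a₂ ∞ (volume.restrict Ω) →
            MemLp b₃ ∞ (volume.restrict Ω) →
            MemLp u (ENNReal.ofReal β) (volume.restrict Ω) →
            IsWeakSupersolution p Ω A B u Du →
            lebNorm b₁ ∞ Ω ≤ d 0 → lebNorm a₁ (ENNReal.ofReal (q / p)) Ω ≤ d 1 →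
            lebNorm b₂ (ENNReal.ofReal (q / p)) Ω ≤ d 2 → lebNorm a₂ ∞ Ω ≤ d 3 →
            lebNorm b₃ ∞ Ω ≤ d 4 →
            eLpNorm (fun x => max (-u x) 0) ∞ (volume.restrict Ω) ≤ (c : ℝ≥0∞) *
                max (eLpNorm (fun x => max (-u x) 0) (ENNReal.ofReal β)
                      (volume.restrict Ω) ^ (β / (N + β)))
                  (eLpNorm (fun x => max (-u x) 0) (ENNReal.ofReal β) (volume.restrict Ω)))
    (by
      intro d c c' hcc h Ω A B a₁ a₂ b₁ b₂ b₃ u Du h1 h2 h3 h4 h5 h6 h7 h8 h9 h10 d0 d1 d2 d3 d4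
      exact (h Ω A B a₁ a₂ b₁ b₂ b₃ u Du h1 h2 h3 h4 h5 h6 h7 h8 h9 h10 d0 d1 d2 d3 d4).trans
        (mul_le_mul' (by exact_mod_cast hcc) le_rfl))
    (by
      intro n
      -- The factor `2` accommodates the norm of `a₁ + b₂`, a sum of two functions of norm at most
      -- `n`.
      set K : ℝ := 2 * n with hK
      have hnK : (n : ℝ) ≤ K := by rw [hK]; linarith [Nat.cast_nonneg (α := ℝ) n]
      -- The maximum with `1` makes `D` positive; `ε > 0` is where `q > N` enters.
      obtain ⟨C, hC⟩ := exists_eLpNorm_top_negPart_le (N := N) (p := p) (β := β)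
        (ε := p / N - p / q) (D := max (recursionConst N p lam K) 1) hp0 hpN hβ0 (by linarith)
        (by linarith) (by positivity)
      refine ⟨C, ?_⟩
      intro d hd Ω A B a₁ a₂ b₁ b₂ b₃ u Du hpos hA hB mb₁ ma₁ mb₂ ma₂ mb₃ mu hu d0 d1 d2 d3 d4
      refine hC _ u mu fun k h hk hkh hfin hm1 hmD => ?_
      have c1 := ae_le_of_lebNorm_top_le ma₂ (d3.trans (hd 3))
      have c2 := ae_le_of_lebNorm_top_le mb₁ (d0.trans (hd 0))
      have c3 := ae_le_of_lebNorm_top_le mb₃ (d4.trans (hd 4))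
      have hab : eLpNorm (fun x => a₁ x + b₂ x) (ENNReal.ofReal (q / p)) (volume.restrict Ω) ≤
          ENNReal.ofReal K := by
        have h1 : (1 : ℝ≥0∞) ≤ ENNReal.ofReal (q / p) := by
          rw [ENNReal.one_le_ofReal, le_div_iff₀ hp0]
          linarith
        refine (eLpNorm_add_le ma₁.1 mb₂.1 h1).trans ?_
        rw [← ENNReal.coe_toNNReal ma₁.2.ne, ← ENNReal.coe_toNNReal mb₂.2.ne]
        have e : ENNReal.ofReal K = ((n : ℝ≥0) : ℝ≥0∞) + ((n : ℝ≥0) : ℝ≥0∞) := by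
          rw [hK, two_mul, ENNReal.ofReal_add (by positivity) (by positivity)]
          simp
        rw [e]
        exact add_le_add (by exact_mod_cast d1.trans (hd 1)) (by exact_mod_cast d2.trans (hd 2))
      refine hu.measure_recursion hp hpN hq hlam (by positivity) hk hpos ?_ ma₁.1.aemeasurable
        mb₂.1.aemeasurable hab hA hB (le_max_left _ _) hkh hfin hm1 hmD
      filter_upwards [c1, c2, c3] with x x1 x2 x3
      simp only [NNReal.coe_natCast] at x1 x2 x3
      exact ⟨x1.trans hnK, x2.trans hnK, x3.trans hnK⟩)
  refine ⟨C, hC, ?_⟩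
  intro Ω A B a₁ a₂ b₁ b₂ b₃ u Du _ _ _ hpos hA hB mb₁ ma₁ mb₂ _ ma₂ _ mb₃ mu hu
  -- The last two arguments of `C` are sums of norms, which dominate the sup norms of `a₂` and `b₃`.
  exact hCP _ Ω A B a₁ a₂ b₁ b₂ b₃ u Du (hpos.mono fun x hx => ⟨hx.1, hx.2.2.1, hx.2.2.2.1⟩)
    hA hB mb₁ ma₁ mb₂ ma₂ mb₃ mu hu le_rfl le_rfl le_rfl le_add_self le_add_self
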